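/- A \emph{moment category} is a category with two classes of morphisms, called active and inert, each containing all isomorphisms and closed under composition, such that every morphism factors as an active morphism followed by an inert one, uniquely up to a unique isomorphism, and such that (M1) every inert morphism has a unique active retraction; (M2) if $fi=g$ with $i$ inert and $f,g$ active, then $f=gr$ for the active retraction $r$ of $i$. A \emph{moment} of $A$ is an endomorphism $\phi$ with active/inert factorisation $\phi=ir$ such that $ri=1$; it \emph{splits over} the domain of $i$. Write $m_A$ for the set of moments of $A$, and $\phi\le\psi$ if $\psi\phi=\phi$. The moments $\phi,\psi$ are \emph{congruent} if $\phi=\phi\psi\phi$ and $\psi=\psi\phi\psi$, and a moment is \emph{centric} if it is congruent only to itself. For $f:A\to B$ and a moment $\phi=ir$ of $A$, the pushforward $f_*(\phi)\in m_B$ is the moment $js$, where $j$ is the inert part of $fi$ and $s$ is the active retraction of $j$. An object $U$ is a \emph{unit} if it has non-identity moments, none of which is centric, and if every active morphism with target $U$ has exactly one inert section. A moment category is \emph{unital} if for each object $A$ there is a pair $(U,\phi)$ of a unit $U$ and an active morphism $\phi:U\to A$, unique up to a unique isomorphism. A moment is \emph{elementary} if it splits over a unit; $\mathrm{el}_A\subseteq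 m_A$ is the set of elementary moments of $A$. For unital moment categories $C,D$, the \emph{wreath product} $C\wr D$ has as objects the tuples $(A,(B_\alpha)_{\alpha\in \mathrm{el}_A})$ with $A$ in $C$ and $B_\alpha$ in $D$, and as morphisms $(A,B_\alpha)\to(A',B'_{\alpha'})$ the tuples consisting of a morphism $f:A\to A'$ in $C$ and of morphisms $f_\alpha^{\alpha'}:B_\alpha\to B'_{\alpha'}$ in $D$, one for each pair $\alpha\in\mathrm{el}_A$, $\alpha'\in \mathrm{el}_{A'}$ with $\alpha'\le f_*(\alpha)$. The component of a composite $gf$ at $(\alpha,\alpha'')$ is $g_{\alpha'}^{\alpha''}f_\alpha^{\alpha'}$ for the unique $\alpha'\in\mathrm{el}_{A'}$ with $\alpha'\le f_*(\alpha)$ and $\alpha''\le g_*(\alpha')$. A morphism of $C\wr D$ is active (inert) if $f$ and all $f_\alpha^{\alpha'}$ are active (inert). \textbf{Proposition.} Let $C$ and $D$ be unital moment categories. (1) $C\wr D$ is a moment category. If $D$ has a unit and any two units of $D$ are isomorphic by exactly one isomorphism, then $C\wr D$ is a unital moment category; if moreover $C$ has a unit and any two units of $C$ are isomorphic by exactly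 one isomorphism, then $C\wr D$ has this property too. (2) The simplex category $\Delta$, with the endpoint-preserving maps as active and the distance-preserving maps ($f(i+1)=f(i)+1$ for all $i$) as inert morphisms, is a unital moment category. Let $\Theta_1=\Delta$, and for $n\ge1$ let $\Theta_{n+1}$ be the category of tuples $([m];T_1,\dots,T_m)$ with $T_i$ in $\Theta_n$, in which a morphism $([m];T_i)\to([m'];T'_j)$ consists of a map $f:[m]\to[m']$ of $\Delta$ and of a morphism $T_i\to T'_j$ whenever $f(i-1)<j\le f(i)$; it is active (inert) if $f$ and all its components are. Then for every $n\ge 1$ Joyal's category $\Theta_n$ is a unital moment category whose unit is unique up to a unique isomorphism, and $\Theta_{n+1}$ is equivalent to $\Delta\wr\Theta_n$ by an equivalence that preserves and reflects active and inert morphisms. -/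

import Mathlib

open CategoryTheory

universe v₁ v₂ u₁ u₂

namespace MomentCat

/-- Two distinguished classes of morphisms, the active and the inert ones. -/
class ActiveInert (C : Type u₁) [Category.{v₁} C] where
  act : ∀ {X Y : C}, (X ⟶ Y) → Prop
  inert : ∀ {X Y : C}, (X ⟶ Y) → Prop

open ActiveInert

/-- A moment category: the active and the inert morphisms form two closed classes (they contain
all isomorphisms and are stable under composition), every morphism factors essentially uniquely as
an active morphism followed by an inert one, and the axioms (M1) and (M2) hold. -/
class IsMomentCategory (C : Type u₁) [Category.{v₁} C] [ActiveInert C] : Prop where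
  act_of_iso : ∀ {X Y : C} (h : X ≅ Y), act h.hom
  inert_of_iso : ∀ {X Y : C} (h : X ≅ Y), inert h.hom
  act_comp : ∀ {X Y Z : C} (f : X ⟶ Y) (g : Y ⟶ Z), act f → act g → act (f ≫ g)
  inert_comp : ∀ {X Y Z : C} (f : X ⟶ Y) (g : Y ⟶ Z), inert f → inert g → inert (f ≫ g)
  exists_fac : ∀ {X Y : C} (f : X ⟶ Y),
    ∃ (Z : C) (a : X ⟶ Z) (i : Z ⟶ Y), act a ∧ inert i ∧ a ≫ i = f
  fac_unique : ∀ {X Y Z Z' : C} (a : X ⟶ Z) (i : Z ⟶ Y) (a' : X ⟶ Z') (i' : Z' ⟶ Y),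
    act a → inert i → act a' → inert i' → a ≫ i = a' ≫ i' →
      ∃! h : Z ≅ Z', a ≫ h.hom = a' ∧ h.hom ≫ i' = i
  /-- (M1): every inert morphism has a unique active retraction. -/
  exists_unique_retraction : ∀ {X Y : C} (i : X ⟶ Y), inert i →
    ∃! r : Y ⟶ X, act r ∧ i ≫ r = 𝟙 X
  /-- (M2): if `f ∘ i = g` with `i` inert and `f`, `g` active, then `f = g ∘ r`, where `r` is the
  active retraction of `i`. -/
  eq_retraction_comp : ∀ {X Y Z : C} (i : X ⟶ Y) (f : Y ⟶ Z) (g : X ⟶ Z) (r : Y ⟶ X),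
    inert i → act f → act g → act r → i ≫ r = 𝟙 X → i ≫ f = g → f = r ≫ g

section Moments

variable {C : Type u₁} [Category.{v₁} C] [ActiveInert C]

/-- A moment of `A` is an endomorphism whose active part is a retraction of its inert part. -/
def IsMoment {A : C} (φ : A ⟶ A) : Prop :=
  ∀ (B : C) (r : A ⟶ B) (i : B ⟶ A), act r → inert i → r ≫ i = φ → i ≫ r = 𝟙 B

/-- The set `m_A` of moments of `A`. -/
def Moment (A : C) : Type v₁ := {φ : A ⟶ A // IsMoment φ}

/-- `φ` is a submoment of `ψ`: one has `ψ ∘ φ = φ`. -/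
def Moment.Sub {A : C} (φ ψ : Moment A) : Prop := φ.1 ≫ ψ.1 = φ.1

/-- Congruence of moments: `φ = φψφ` and `ψ = ψφψ`. -/
def Moment.Congr {A : C} (φ ψ : Moment A) : Prop :=
  φ.1 = φ.1 ≫ ψ.1 ≫ φ.1 ∧ ψ.1 = ψ.1 ≫ φ.1 ≫ ψ.1

/-- A moment is centric if it is the only element of its congruence class. -/
def Moment.Centric {A : C} (φ : Moment A) : Prop := ∀ ψ : Moment A, φ.Congr ψ → ψ = φ

/-- The moment `φ` splits over `B`. -/
def Moment.SplitsOver {A : C} (φ : Moment A) (B : C) : Prop :=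
  ∃ (r : A ⟶ B) (i : B ⟶ A), act r ∧ inert i ∧ r ≫ i = φ.1

/-- `U` is primitive if it has non-identity moments, but none of them is centric. -/
def IsPrimitive (U : C) : Prop :=
  (∃ φ : Moment U, φ.1 ≠ 𝟙 U) ∧ ∀ φ : Moment U, φ.1 ≠ 𝟙 U → ¬ φ.Centric

/-- `U` is a unit if (U1) it is primitive and (U2) each active morphism with target `U` has one
and only one inert section. -/
def IsUnitObj (U : C) : Prop :=
  IsPrimitive U ∧ ∀ (X : C) (f : X ⟶ U), act f → ∃! i : U ⟶ X, inert i ∧ i ≫ f = 𝟙 U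

/-- A moment is elementary if it splits over a unit. -/
def Moment.IsElementary {A : C} (φ : Moment A) : Prop := ∃ U : C, IsUnitObj U ∧ φ.SplitsOver U

/-- The set `el_A` of elementary moments of `A`. -/
def El (A : C) : Type v₁ := {φ : Moment A // φ.IsElementary}

end Moments

/-- A moment category is unital if for each object `A` there is an essentially unique pair
consisting of a unit `U` and an active morphism `U ⟶ A`. -/
class IsUnital (C : Type u₁) [Category.{v₁} C] [ActiveInert C] : Prop
    extends IsMomentCategory C where
  exists_unit : ∀ A : C, ∃ (U : C) (φ : U ⟶ A), IsUnitObj U ∧ act φ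
  unit_unique : ∀ {A U U' : C} (φ : U ⟶ A) (φ' : U' ⟶ A), IsUnitObj U → IsUnitObj U' →
    act φ → act φ' → ∃! h : U ≅ U', h.hom ≫ φ' = φ

/-- There is a unit, and it is unique up to unique isomorphism. -/
def HasEssentiallyUniqueUnit (C : Type u₁) [Category.{v₁} C] [ActiveInert C] : Prop :=
  (∃ U : C, IsUnitObj U) ∧
    ∀ U U' : C, IsUnitObj U → IsUnitObj U' → Nonempty (Unique (U ≅ U'))

/-! Basic facts about moment categories, needed to define the pushforward of moments. -/

section Basic

variable {C : Type u₁} [Category.{v₁} C] [ActiveInert C] [IsMomentCategory C]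

open IsMomentCategory

lemma act_id (X : C) : act (𝟙 X) := act_of_iso (Iso.refl X)

lemma inert_id (X : C) : inert (𝟙 X) := inert_of_iso (Iso.refl X)

lemma isMoment_of_retraction {A B : C} {r : A ⟶ B} {i : B ⟶ A} (hr : act r) (hi : inert i)
    (h : i ≫ r = 𝟙 B) : IsMoment (r ≫ i) := by
  intro B' r' i' hr' hi' e
  obtain ⟨k, ⟨h1, h2⟩, -⟩ := fac_unique r i r' i' hr hi hr' hi' e.symm
  have e1 : i' = k.inv ≫ i := by simp [← h2]
  rw [e1, ← h1, Category.assoc, reassoc_of% h]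
  simp

/-- If `a` and `a ≫ b` are active, so is `b`. -/
lemma act_of_act_comp {X Y Z : C} {a : X ⟶ Y} {b : Y ⟶ Z} (ha : act a) (hab : act (a ≫ b)) :
    act b := by
  obtain ⟨W, p, q, hp, hq, rfl⟩ := exists_fac b
  obtain ⟨k, ⟨-, h2⟩, -⟩ := fac_unique (a ≫ p) q (a ≫ p ≫ q) (𝟙 Z) (act_comp _ _ ha hp) hq hab
    (inert_id Z) (by simp)
  have hq' : q = k.hom := by simpa using h2.symm
  rw [hq']
  exact act_comp _ _ hp (act_of_iso k)

/-- If `i` and `k ≫ i` are inert, so is `k`. -/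
lemma inert_of_comp_inert {X Y Z : C} {k : X ⟶ Y} {i : Y ⟶ Z} (hi : inert i)
    (hki : inert (k ≫ i)) : inert k := by
  obtain ⟨W, p, q, hp, hq, rfl⟩ := exists_fac k
  obtain ⟨e, ⟨h1, -⟩, -⟩ := fac_unique (𝟙 X) ((p ≫ q) ≫ i) p (q ≫ i) (act_id X) hki hp
    (inert_comp _ _ hq hi) (by simp)
  have hp' : p = e.hom := by simpa using h1.symm
  rw [hp']
  exact inert_comp _ _ (inert_of_iso e) hq

lemma retraction_unique {X Y : C} {i : X ⟶ Y} (hi : inert i) {r s : Y ⟶ X} (hr : act r)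
    (hs : act s) (h : i ≫ r = 𝟙 X) (h' : i ≫ s = 𝟙 X) : r = s :=
  (exists_unique_retraction i hi).unique ⟨hr, h⟩ ⟨hs, h'⟩

lemma section_unique {U X : C} (hU : IsUnitObj U) {f : X ⟶ U} (hf : act f) {i j : U ⟶ X}
    (hi : inert i) (hj : inert j) (h : i ≫ f = 𝟙 U) (h' : j ≫ f = 𝟙 U) : i = j :=
  (hU.2 X f hf).unique ⟨hi, h⟩ ⟨hj, h'⟩

lemma Moment.exists_split {A : C} (φ : Moment A) :
    ∃ (B : C) (r : A ⟶ B) (i : B ⟶ A), act r ∧ inert i ∧ i ≫ r = 𝟙 B ∧ r ≫ i = φ.1 := by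
  obtain ⟨B, r, i, hr, hi, e⟩ := exists_fac φ.1
  exact ⟨B, r, i, hr, hi, φ.2 B r i hr hi e, e⟩

/-- The data entering into the definition of the pushforward of `φ` along `f`: a splitting of `φ`,
an active/inert factorisation of `f ∘ φ_in`, and the active retraction of its inert part. -/
lemma exists_pushforward {A B : C} (f : A ⟶ B) (φ : Moment A) :
    ∃ ψ : Moment B, ∃ (A' B' : C) (r : A ⟶ A') (i : A' ⟶ A) (f' : A' ⟶ B') (j : B' ⟶ B)
      (s : B ⟶ B'), act r ∧ inert i ∧ r ≫ i = φ.1 ∧ act f' ∧ inert j ∧ f' ≫ j = i ≫ f ∧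
      act s ∧ j ≫ s = 𝟙 B' ∧ s ≫ j = ψ.1 := by
  obtain ⟨A', r, i, hr, hi, -, e⟩ := φ.exists_split
  obtain ⟨B', f', j, hf', hj, e'⟩ := exists_fac (i ≫ f)
  obtain ⟨s, ⟨hs, hs'⟩, -⟩ := exists_unique_retraction j hj
  exact ⟨⟨s ≫ j, isMoment_of_retraction hs hj hs'⟩, A', B', r, i, f', j, s, hr, hi, e, hf', hj, e',
    hs, hs', rfl⟩

/-- The pushforward `f_*(φ)` of a moment `φ` of `A` along `f : A ⟶ B`; by `push_eq` it does not
depend on the choices made. -/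
noncomputable def push {A B : C} (f : A ⟶ B) (φ : Moment A) : Moment B :=
  (exists_pushforward f φ).choose

lemma push_eq {A B A' B' : C} (f : A ⟶ B) (φ : Moment A) {r : A ⟶ A'} {i : A' ⟶ A}
    {f' : A' ⟶ B'} {j : B' ⟶ B} {s : B ⟶ B'} (hr : act r) (hi : inert i) (e : r ≫ i = φ.1)
    (hf' : act f') (hj : inert j) (e' : f' ≫ j = i ≫ f) (hs : act s) (hs' : j ≫ s = 𝟙 B') :
    (push f φ).1 = s ≫ j := by
  obtain ⟨A₁, B₁, r₁, i₁, f₁, j₁, s₁, hr₁, hi₁, e₁, hf₁, hj₁, e₁', hs₁, hs₁', e₂⟩ :=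
    (exists_pushforward f φ).choose_spec
  change s₁ ≫ j₁ = (push f φ).1 at e₂
  rw [← e₂]
  obtain ⟨h, ⟨-, h2⟩, -⟩ := fac_unique r₁ i₁ r i hr₁ hi₁ hr hi (e₁.trans e.symm)
  obtain ⟨k, ⟨-, k2⟩, -⟩ := fac_unique f₁ j₁ (h.hom ≫ f') j hf₁ hj₁
    (act_comp _ _ (act_of_iso h) hf') hj (by rw [e₁', Category.assoc, e', reassoc_of% h2])
  have : s₁ = s ≫ k.inv := by
    refine retraction_unique hj₁ hs₁ (act_comp _ _ hs (act_of_iso k.symm)) hs₁' ?_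
    rw [← k2, Category.assoc, reassoc_of% hs']
    simp
  rw [this, ← k2]
  simp

/-- If `j` is the inert part of `f ∘ i`, then the active retractions form a commutative square. -/
lemma retraction_square {A B A' B' : C} {f : A ⟶ B} {r : A ⟶ A'} {i : A' ⟶ A}
    {f' : A' ⟶ B'} {j : B' ⟶ B} {s : B ⟶ B'} (hr : act r) (hi : inert i) (hir : i ≫ r = 𝟙 A')
    (hf' : act f') (hj : inert j) (e' : f' ≫ j = i ≫ f) (hs : act s) (hs' : j ≫ s = 𝟙 B') :
    f ≫ s = r ≫ f' := by
  obtain ⟨E, a, b, ha, hb, rfl⟩ := exists_fac f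
  obtain ⟨F, p, c, hp, hc, hpc⟩ := exists_fac (i ≫ a)
  obtain ⟨k, ⟨-, k2⟩, -⟩ := fac_unique f' j p (c ≫ b) hf' hj hp (inert_comp _ _ hc hb)
    (by rw [e', reassoc_of% hpc])
  obtain ⟨b', ⟨hb', hbb'⟩, -⟩ := exists_unique_retraction b hb
  obtain ⟨c', ⟨hc', hcc'⟩, -⟩ := exists_unique_retraction c hc
  have : s = b' ≫ c' ≫ k.inv := by
    refine retraction_unique hj hs
      (act_comp _ _ hb' (act_comp _ _ hc' (act_of_iso k.symm))) hs' ?_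
    rw [← k2]
    simp only [Category.assoc]
    rw [reassoc_of% hbb', reassoc_of% hcc', Iso.hom_inv_id]
  have hact : act ((a ≫ b) ≫ s) := by
    rw [this]
    simp only [Category.assoc]
    rw [reassoc_of% hbb']
    exact act_comp _ _ ha (act_comp _ _ hc' (act_of_iso k.symm))
  refine eq_retraction_comp i _ f' r hi hact hf' hr hir ?_
  rw [← Category.assoc, ← e', Category.assoc, hs', Category.comp_id]

lemma push_id {A : C} (φ : Moment A) : push (𝟙 A) φ = φ := by
  obtain ⟨B, r, i, hr, hi, hir, e⟩ := φ.exists_split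
  refine Subtype.ext ?_
  rw [push_eq (𝟙 A) φ hr hi e (act_id B) hi (by simp) hr hir, e]

lemma push_comp {A B D : C} (f : A ⟶ B) (g : B ⟶ D) (φ : Moment A) :
    push (f ≫ g) φ = push g (push f φ) := by
  obtain ⟨A', r, i, hr, hi, hir, e⟩ := φ.exists_split
  obtain ⟨B', f', j, hf', hj, e'⟩ := exists_fac (i ≫ f)
  obtain ⟨s, ⟨hs, hs'⟩, -⟩ := exists_unique_retraction j hj
  obtain ⟨D', g', k, hg', hk, e''⟩ := exists_fac (j ≫ g)
  obtain ⟨t, ⟨ht, ht'⟩, -⟩ := exists_unique_retraction k hk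
  refine Subtype.ext ?_
  rw [push_eq (f ≫ g) φ hr hi e (act_comp _ _ hf' hg') hk
      (by rw [Category.assoc, e'', reassoc_of% e']) ht ht',
    push_eq g (push f φ) hs hj (push_eq f φ hr hi e hf' hj e' hs hs').symm hg' hk e'' ht ht']

lemma El.exists_split {A : C} (α : El A) :
    ∃ (U : C) (r : A ⟶ U) (i : U ⟶ A), IsUnitObj U ∧ act r ∧ inert i ∧ i ≫ r = 𝟙 U ∧
      r ≫ i = α.1.1 := by
  obtain ⟨U, hU, r, i, hr, hi, e⟩ := α.2
  exact ⟨U, r, i, hU, hr, hi, α.1.2 U r i hr hi e, e⟩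

/-- A moment whose active part has only one inert section is centric. -/
lemma centric_of_section_unique {A B : C} {r : A ⟶ B} {i : B ⟶ A} (hr : act r) (hi : inert i)
    (hir : i ≫ r = 𝟙 B) (h : ∀ j : B ⟶ A, inert j → j ≫ r = 𝟙 B → j = i) :
    Moment.Centric (⟨r ≫ i, isMoment_of_retraction hr hi hir⟩ : Moment A) := by
  intro ψ hψ
  obtain ⟨B', s, j, hs, hj, hjs, e⟩ := ψ.exists_split
  obtain ⟨h1, h2⟩ := hψ
  dsimp only at h1 h2
  rw [← e] at h1 h2
  have k1 : i ≫ s ≫ j ≫ r = 𝟙 B := by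
    have := congrArg (fun t => i ≫ t ≫ r) h1
    simp only [Category.assoc, hir, reassoc_of% hir, Category.comp_id] at this
    exact this.symm
  have k2 : j ≫ r ≫ i ≫ s = 𝟙 B' := by
    have := congrArg (fun t => j ≫ t ≫ s) h2
    simp only [Category.assoc, hjs, reassoc_of% hjs, Category.comp_id] at this
    exact this.symm
  let w : B ≅ B' := ⟨i ≫ s, j ≫ r, by simpa using k1, by simpa using k2⟩
  have hji : w.hom ≫ j = i := by
    refine h _ (inert_comp _ _ (inert_of_iso w) hj) ?_
    simpa [w] using k1
  have hs2 : s = r ≫ w.hom := by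
    refine retraction_unique hj hs (act_comp _ _ hr (act_of_iso w)) hjs ?_
    simpa [w] using k2
  refine Subtype.ext ?_
  change ψ.1 = r ≫ i
  rw [← e, hs2, Category.assoc, hji]

/-- Active morphisms between units are invertible. -/
lemma exists_iso_of_act {U V : C} (hU : IsUnitObj U) (hV : IsUnitObj V) {f : U ⟶ V}
    (hf : act f) : ∃ h : U ≅ V, h.hom = f := by
  obtain ⟨i, ⟨hi, hif⟩, huniq⟩ := hV.2 U f hf
  have hc := centric_of_section_unique hf hi hif (fun j hj hj' => huniq j ⟨hj, hj'⟩)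
  have : f ≫ i = 𝟙 U := by
    by_contra hne
    exact hU.1.2 _ hne hc
  exact ⟨⟨f, i, this, hif⟩, rfl⟩

/-- For each elementary moment `γ` of the target of `g` there is at most one elementary moment `β`
of the source with `γ ≤ g_*(β)`. -/
lemma El.eq_of_sub_push {B D : C} (g : B ⟶ D) (γ : El D) (β₁ β₂ : El B)
    (h₁ : γ.1.Sub (push g β₁.1)) (h₂ : γ.1.Sub (push g β₂.1)) : β₁ = β₂ := by
  obtain ⟨W, s, j, hW, hs, hj, hjs, e⟩ := γ.exists_split
  have key : ∀ β : El B, γ.1.Sub (push g β.1) →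
      ∃ l : W ⟶ B, inert l ∧ act (g ≫ s) ∧ l ≫ g ≫ s = 𝟙 W ∧ (g ≫ s) ≫ l = β.1.1 := by
    intro β hβ
    obtain ⟨U, r, i, hU, hr, hi, hir, e'⟩ := β.exists_split
    obtain ⟨D', g', k, hg', hk, e''⟩ := exists_fac (i ≫ g)
    obtain ⟨t, ⟨ht, ht'⟩, -⟩ := exists_unique_retraction k hk
    unfold Moment.Sub at hβ
    rw [push_eq g β.1 hr hi e' hg' hk e'' ht ht', ← e] at hβ
    have hj' : (j ≫ t) ≫ k = j := by
      have := congrArg (fun x => j ≫ x) hβ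
      simp only [Category.assoc, reassoc_of% hjs] at this
      simpa using this
    have hin : inert (j ≫ t) := inert_of_comp_inert hk (hj'.symm ▸ hj)
    obtain ⟨q, ⟨hq, hq'⟩, -⟩ := exists_unique_retraction (j ≫ t) hin
    have hstq : s = t ≫ q := by
      refine retraction_unique hj hs (act_comp _ _ ht hq) hjs ?_
      simpa using hq'
    have sq := retraction_square hr hi hir hg' hk e'' ht ht'
    obtain ⟨w, hw⟩ := exists_iso_of_act hU hW (act_comp _ _ hg' hq)
    have hgs : g ≫ s = r ≫ w.hom := by
      rw [hstq, ← Category.assoc, sq, Category.assoc, hw]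
    refine ⟨w.inv ≫ i, inert_comp _ _ (inert_of_iso w.symm) hi, ?_, ?_, ?_⟩
    · rw [hgs]
      exact act_comp _ _ hr (act_of_iso w)
    · rw [hgs, Category.assoc, reassoc_of% hir, w.inv_hom_id]
    · rw [hgs, Category.assoc, w.hom_inv_id_assoc, e']
  obtain ⟨l₁, hl₁, ha, hs₁, e₁⟩ := key β₁ h₁
  obtain ⟨l₂, hl₂, -, hs₂, e₂⟩ := key β₂ h₂
  have : l₁ = l₂ := section_unique hW ha hl₁ hl₂ hs₁ hs₂
  refine Subtype.ext (Subtype.ext ?_)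
  rw [← e₁, ← e₂, this]

/-- If `γ ≤ (gf)_*(α)` then there is an elementary moment `β ≤ f_*(α)` with `γ ≤ g_*(β)`. -/
lemma El.exists_mid {A B D : C} (f : A ⟶ B) (g : B ⟶ D) (α : El A) (γ : El D)
    (h : γ.1.Sub (push (f ≫ g) α.1)) :
    ∃ β : El B, β.1.Sub (push f α.1) ∧ γ.1.Sub (push g β.1) := by
  obtain ⟨W, s, j, hW, hs, hj, hjs, e⟩ := γ.exists_split
  obtain ⟨U, r, i, hU, hr, hi, hir, e'⟩ := α.exists_split
  obtain ⟨B', f', i', hf', hi', ef⟩ := exists_fac (i ≫ f)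
  obtain ⟨r', ⟨hr', hir'⟩, -⟩ := exists_unique_retraction i' hi'
  obtain ⟨D', g', k, hg', hk, eg⟩ := exists_fac (i' ≫ g)
  obtain ⟨t, ⟨ht, ht'⟩, -⟩ := exists_unique_retraction k hk
  unfold Moment.Sub at h
  rw [push_eq (f ≫ g) α.1 hr hi e' (act_comp _ _ hf' hg') hk
      (by rw [Category.assoc, eg, reassoc_of% ef]) ht ht', ← e] at h
  have hj' : (j ≫ t) ≫ k = j := by
    have := congrArg (fun x => j ≫ x) h
    simp only [Category.assoc, reassoc_of% hjs] at this
    simpa using this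
  have hin : inert (j ≫ t) := inert_of_comp_inert hk (hj'.symm ▸ hj)
  obtain ⟨q, ⟨hq, hq'⟩, -⟩ := exists_unique_retraction (j ≫ t) hin
  obtain ⟨l, ⟨hl, hl'⟩, -⟩ := hW.2 B' (g' ≫ q) (act_comp _ _ hg' hq)
  have hli : inert (l ≫ i') := inert_comp _ _ hl hi'
  obtain ⟨p, ⟨hp, hp'⟩, -⟩ := exists_unique_retraction (l ≫ i') hli
  let β : El B := ⟨⟨p ≫ l ≫ i', isMoment_of_retraction hp hli hp'⟩, W, hW, p, l ≫ i', hp, hli, rfl⟩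
  refine ⟨β, ?_, ?_⟩
  · unfold Moment.Sub
    rw [push_eq f α.1 hr hi e' hf' hi' ef hr' hir']
    change (p ≫ l ≫ i') ≫ r' ≫ i' = p ≫ l ≫ i'
    simp only [Category.assoc]
    rw [reassoc_of% hir']
  · obtain ⟨E, a, b, ha, hb, eab⟩ := exists_fac (l ≫ g')
    have hbk : inert (b ≫ k) := inert_comp _ _ hb hk
    obtain ⟨z, ⟨hz, hz'⟩, -⟩ := exists_unique_retraction (b ≫ k) hbk
    have habq : a ≫ b ≫ q = 𝟙 W := by rw [reassoc_of% eab]; exact hl'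
    have hbq : act (b ≫ q) := act_of_act_comp ha (by rw [habq]; exact act_id W)
    obtain ⟨c, ⟨hc, hc'⟩, -⟩ := hW.2 E (b ≫ q) hbq
    have hcb : c ≫ b = j ≫ t :=
      section_unique hW hq (inert_comp _ _ hc hb) hin (by simpa using hc') hq'
    unfold Moment.Sub
    rw [push_eq g β.1 hp hli rfl ha hbk (by simp only [Category.assoc]; rw [reassoc_of% eab, eg])
      hz hz', ← e]
    have : j = c ≫ b ≫ k := by rw [reassoc_of% hcb]; simpa using hj'.symm
    rw [Category.assoc]
    congr 1
    rw [this]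
    simp only [Category.assoc] at hz' ⊢
    rw [reassoc_of% hz']

lemma El.sub_push_id {A : C} (α : El A) : α.1.Sub (push (𝟙 A) α.1) := by
  rw [push_id]
  obtain ⟨U, r, i, -, -, -, hir, e⟩ := α.exists_split
  unfold Moment.Sub
  rw [← e, Category.assoc, reassoc_of% hir]

lemma El.eq_of_sub_push_id {A : C} {α α' : El A} (h : α'.1.Sub (push (𝟙 A) α.1)) : α = α' :=
  El.eq_of_sub_push (𝟙 A) α' α α' h α'.sub_push_id

lemma Moment.Sub.trans_push {A B : C} (f : A ⟶ B) {φ ψ : Moment A} (h : φ.Sub ψ) :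
    (push f φ).Sub (push f ψ) := by
  obtain ⟨A₁, r, i, hr, hi, hir, e⟩ := φ.exists_split
  obtain ⟨A₂, s, j, hs, hj, hjs, e'⟩ := ψ.exists_split
  obtain ⟨B₂, f₂, k, hf₂, hk, ek⟩ := exists_fac (j ≫ f)
  obtain ⟨t, ⟨ht, ht'⟩, -⟩ := exists_unique_retraction k hk
  unfold Moment.Sub at h
  rw [← e, ← e'] at h
  have hij : (i ≫ s) ≫ j = i := by
    have := congrArg (fun x => i ≫ x) h
    simp only [Category.assoc, reassoc_of% hir] at this
    simpa using this
  obtain ⟨B₁, f₁, l, hf₁, hl, el⟩ := exists_fac ((i ≫ s) ≫ f₂)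
  obtain ⟨z, ⟨hz, hz'⟩, -⟩ := exists_unique_retraction (l ≫ k) (inert_comp _ _ hl hk)
  unfold Moment.Sub
  rw [push_eq f φ hr hi e hf₁ (inert_comp _ _ hl hk)
    (by rw [reassoc_of% el, ek, ← Category.assoc, ← Category.assoc, hij]) hz hz',
    push_eq f ψ hs hj e' hf₂ hk ek ht ht']
  simp only [Category.assoc]
  rw [reassoc_of% ht']

lemma Moment.Sub.trans {A : C} {φ ψ χ : Moment A} (h : φ.Sub ψ) (h' : ψ.Sub χ) : φ.Sub χ := by
  unfold Moment.Sub at *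
  rw [← h, Category.assoc, h']

lemma El.sub_push_comp {A B D : C} {f : A ⟶ B} {g : B ⟶ D} {α : El A} {β : El B} {γ : El D}
    (h : β.1.Sub (push f α.1)) (h' : γ.1.Sub (push g β.1)) :
    γ.1.Sub (push (f ≫ g) α.1) := by
  rw [push_comp]
  exact h'.trans (h.trans_push g)

end Basic

/-! The wreath product. -/

section Wreath

/-- An object `(A, B_α)` of the wreath product: an object `A` of `C` and a family of objects of `D`
indexed by the elementary moments of `A`. -/
structure Wreath (C : Type u₁) [Category.{v₁} C] [ActiveInert C] (D : Type u₂) :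
    Type (max u₁ v₁ u₂) where
  base : C
  fam : El base → D

variable {C : Type u₁} [Category.{v₁} C] [ActiveInert C] [IsMomentCategory C]
  {D : Type u₂} [Category.{v₂} D]

/-- A morphism of the wreath product: a morphism `f : A ⟶ A'` and morphisms `B_α ⟶ B'_α'` whenever
`α' ≤ f_*(α)`. -/
@[ext]
structure Wreath.Hom (X Y : Wreath C D) : Type (max v₁ v₂) where
  base : X.base ⟶ Y.base
  app : ∀ (α : El X.base) (α' : El Y.base), α'.1.Sub (push base α.1) → (X.fam α ⟶ Y.fam α')

/-- Identities: the components are the identities of the `B_α`; indeed `α' ≤ α` implies `α' = α`. -/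
def Wreath.Hom.id (X : Wreath C D) : Wreath.Hom X X where
  base := 𝟙 X.base
  app _ _ h := eqToHom (congrArg X.fam (El.eq_of_sub_push_id h))

/-- Composition: the component at `α'' ≤ (gf)_*(α)` is the composite of the components of `f` at
`(α, α')` and of `g` at `(α', α'')` for the unique `α' ≤ f_*(α)` with `α'' ≤ g_*(α')`. -/
noncomputable def Wreath.Hom.comp {X Y Z : Wreath C D} (f : Wreath.Hom X Y) (g : Wreath.Hom Y Z) :
    Wreath.Hom X Z where
  base := f.base ≫ g.base
  app α α'' h :=
    f.app α _ (El.exists_mid f.base g.base α α'' h).choose_spec.1 ≫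
      g.app _ α'' (El.exists_mid f.base g.base α α'' h).choose_spec.2

lemma Wreath.Hom.comp_app {X Y Z : Wreath C D} (f : Wreath.Hom X Y) (g : Wreath.Hom Y Z)
    (α : El X.base) (β : El Y.base) (γ : El Z.base) (h₁ : β.1.Sub (push f.base α.1))
    (h₂ : γ.1.Sub (push g.base β.1)) (h : γ.1.Sub (push (f.base ≫ g.base) α.1)) :
    (Wreath.Hom.comp f g).app α γ h = f.app α β h₁ ≫ g.app β γ h₂ := by
  have hs := (El.exists_mid f.base g.base α γ h).choose_spec
  have e : β = (El.exists_mid f.base g.base α γ h).choose :=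
    El.eq_of_sub_push g.base γ _ _ h₂ hs.2
  subst e
  rfl

lemma Wreath.Hom.ext' {X Y : Wreath C D} (f g : Wreath.Hom X Y) (hb : f.base = g.base)
    (ha : ∀ α α' h h', f.app α α' h = g.app α α' h') : f = g := by
  obtain ⟨fb, fa⟩ := f
  obtain ⟨gb, ga⟩ := g
  dsimp only at hb
  subst hb
  congr 1
  funext α α' h
  exact ha α α' h h

noncomputable instance Wreath.instCategory : Category.{max v₁ v₂} (Wreath C D) where
  Hom := Wreath.Hom
  id := Wreath.Hom.id
  comp := Wreath.Hom.comp
  id_comp {X Y} f := by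
    refine Wreath.Hom.ext' _ _ (Category.id_comp _) fun α α' h h' => ?_
    rw [Wreath.Hom.comp_app (Wreath.Hom.id X) f α α α' α.sub_push_id h' h]
    exact Category.id_comp _
  comp_id {X Y} f := by
    refine Wreath.Hom.ext' _ _ (Category.comp_id _) fun α α' h h' => ?_
    rw [Wreath.Hom.comp_app f (Wreath.Hom.id Y) α α' α' h' α'.sub_push_id h]
    exact Category.comp_id _
  assoc {W X Y Z} f g k := by
    refine Wreath.Hom.ext' _ _ (Category.assoc _ _ _) fun α δ h h' => ?_
    obtain ⟨γ, hγ, hδ⟩ := El.exists_mid (f.base ≫ g.base) k.base α δ h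
    obtain ⟨β, hβ, hγ'⟩ := El.exists_mid f.base g.base α γ hγ
    rw [Wreath.Hom.comp_app (Wreath.Hom.comp f g) k α γ δ hγ hδ h,
      Wreath.Hom.comp_app f g α β γ hβ hγ' hγ,
      Wreath.Hom.comp_app f (Wreath.Hom.comp g k) α β δ hβ (El.sub_push_comp hγ' hδ) h',
      Wreath.Hom.comp_app g k β γ δ hγ' hδ, Category.assoc]

/-- A morphism of the wreath product is active (inert) if its base and all its components are. -/
instance Wreath.instActiveInert [ActiveInert D] : ActiveInert (Wreath C D) where
  act {X Y} (f : Wreath.Hom X Y) := act f.base ∧ ∀ α α' h, act (f.app α α' h)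
  inert {X Y} (f : Wreath.Hom X Y) := inert f.base ∧ ∀ α α' h, inert (f.app α α' h)

end Wreath

/-! The simplex category and Joyal's categories `Θ_n`. -/

section Theta

/-- A simplicial operator is active if it preserves endpoints, and inert if it preserves
distances. -/
instance : ActiveInert SimplexCategory where
  act {X Y} f := f.toOrderHom 0 = 0 ∧ f.toOrderHom (Fin.last X.len) = Fin.last Y.len
  inert {X _} f :=
    ∀ i : Fin X.len, (f.toOrderHom i.succ : ℕ) = (f.toOrderHom i.castSucc : ℕ) + 1

/-- Objects of the classical wreath product of the simplex category with `D`: tuples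
`([m]; B_1, …, B_m)`. -/
structure DeltaWreath (D : Type u₂) : Type u₂ where
  base : SimplexCategory
  fam : Fin base.len → D

/-- For `f : [m] ⟶ [n]`, the segment `j` of `[n]` lies in the interval spanned by the image of the
segment `i` of `[m]`. Segments are indexed from `0`: the segment `i` has endpoints `i`, `i + 1`. -/
def Covers {X Y : SimplexCategory} (f : X ⟶ Y) (i : Fin X.len) (j : Fin Y.len) : Prop :=
  f.toOrderHom i.castSucc ≤ j.castSucc ∧ j.succ ≤ f.toOrderHom i.succ

lemma Covers.eq {X Y : SimplexCategory} {f : X ⟶ Y} {i i' : Fin X.len} {j : Fin Y.len}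
    (h : Covers f i j) (h' : Covers f i' j) : i = i' := by
  by_contra hne
  rcases lt_or_gt_of_ne hne with hlt | hlt
  · have h1 := f.toOrderHom.monotone (show i.succ ≤ i'.castSucc from hlt)
    exact absurd (h.2.trans (h1.trans h'.1)) (by simp [Fin.le_def])
  · have h1 := f.toOrderHom.monotone (show i'.succ ≤ i.castSucc from hlt)
    exact absurd (h'.2.trans (h1.trans h.1)) (by simp [Fin.le_def])

lemma covers_id {X : SimplexCategory} (i : Fin X.len) : Covers (𝟙 X) i i :=
  ⟨le_refl _, le_refl _⟩

lemma Covers.comp {X Y Z : SimplexCategory} {f : X ⟶ Y} {g : Y ⟶ Z} {i : Fin X.len}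
    {j : Fin Y.len} {k : Fin Z.len} (h : Covers f i j) (h' : Covers g j k) :
    Covers (f ≫ g) i k :=
  ⟨(g.toOrderHom.monotone h.1).trans h'.1, h'.2.trans (g.toOrderHom.monotone h.2)⟩

lemma Covers.exists_mid {X Y Z : SimplexCategory} {f : X ⟶ Y} {g : Y ⟶ Z} {i : Fin X.len}
    {k : Fin Z.len} (h : Covers (f ≫ g) i k) : ∃ j : Fin Y.len, Covers f i j ∧ Covers g j k := by
  have h1 : g.toOrderHom (f.toOrderHom i.castSucc) ≤ k.castSucc := h.1
  have h2 : k.succ ≤ g.toOrderHom (f.toOrderHom i.succ) := h.2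
  classical
  have key : ∀ n : ℕ, ∀ hn : n < Y.len + 1, (f.toOrderHom i.castSucc : ℕ) ≤ n →
      k.succ ≤ g.toOrderHom ⟨n, hn⟩ →
      ∃ j : Fin Y.len, f.toOrderHom i.castSucc ≤ j.castSucc ∧ (j : ℕ) < n ∧ Covers g j k := by
    intro n
    induction n with
    | zero =>
      intro hn hle hk
      have : f.toOrderHom i.castSucc = ⟨0, hn⟩ := Fin.ext (by simpa using hle)
      rw [this] at h1
      exact absurd (hk.trans h1) (by simp [Fin.le_def])
    | succ n ih =>
      intro hn hle hk
      rcases Nat.lt_or_ge n (f.toOrderHom i.castSucc : ℕ) with hlt | hge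
      · have : f.toOrderHom i.castSucc = ⟨n + 1, hn⟩ := Fin.ext (by simp only; omega)
        rw [this] at h1
        exact absurd (hk.trans h1) (by simp [Fin.le_def])
      · by_cases hc : k.succ ≤ g.toOrderHom ⟨n, by omega⟩
        · obtain ⟨j, hj1, hj2, hj3⟩ := ih (by omega) hge hc
          exact ⟨j, hj1, by omega, hj3⟩
        · refine ⟨⟨n, by omega⟩, hge, by simp, ?_, hk⟩
          rw [not_le] at hc
          exact Fin.le_def.2 (Nat.lt_succ_iff.1 (by simpa using Fin.lt_def.1 hc))
  obtain ⟨j, hj1, hj2, hj3⟩ := key (f.toOrderHom i.succ : ℕ) (f.toOrderHom i.succ).2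
    (f.toOrderHom.monotone (Fin.castSucc_lt_succ).le) h2
  exact ⟨j, ⟨hj1, hj2⟩, hj3⟩

variable {D : Type u₂} [Category.{v₂} D]

/-- A morphism `([m]; B_i) ⟶ ([n]; B'_j)`: a simplicial operator `f : [m] ⟶ [n]` and morphisms
`B_i ⟶ B'_j` whenever the segment `j` lies in the image interval of the segment `i`. -/
structure DeltaWreath.Hom (X Y : DeltaWreath D) : Type v₂ where
  base : X.base ⟶ Y.base
  app : ∀ (i : Fin X.base.len) (j : Fin Y.base.len), Covers base i j → (X.fam i ⟶ Y.fam j)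

def DeltaWreath.Hom.id (X : DeltaWreath D) : DeltaWreath.Hom X X where
  base := 𝟙 X.base
  app _ j h := eqToHom (congrArg X.fam (h.eq (covers_id j)))

noncomputable def DeltaWreath.Hom.comp {X Y Z : DeltaWreath D} (f : DeltaWreath.Hom X Y)
    (g : DeltaWreath.Hom Y Z) : DeltaWreath.Hom X Z where
  base := f.base ≫ g.base
  app i k h := f.app i _ h.exists_mid.choose_spec.1 ≫ g.app _ k h.exists_mid.choose_spec.2

lemma DeltaWreath.Hom.comp_app {X Y Z : DeltaWreath D} (f : DeltaWreath.Hom X Y)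
    (g : DeltaWreath.Hom Y Z) (i : Fin X.base.len) (j : Fin Y.base.len) (k : Fin Z.base.len)
    (h₁ : Covers f.base i j) (h₂ : Covers g.base j k) (h : Covers (f.base ≫ g.base) i k) :
    (DeltaWreath.Hom.comp f g).app i k h = f.app i j h₁ ≫ g.app j k h₂ := by
  have e : j = h.exists_mid.choose := h₂.eq h.exists_mid.choose_spec.2
  subst e
  rfl

lemma DeltaWreath.Hom.ext' {X Y : DeltaWreath D} (f g : DeltaWreath.Hom X Y)
    (hb : f.base = g.base) (ha : ∀ i j h h', f.app i j h = g.app i j h') : f = g := by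
  obtain ⟨fb, fa⟩ := f
  obtain ⟨gb, ga⟩ := g
  dsimp only at hb
  subst hb
  congr 1
  funext i j h
  exact ha i j h h

noncomputable instance DeltaWreath.instCategory : Category.{v₂} (DeltaWreath D) where
  Hom := DeltaWreath.Hom
  id := DeltaWreath.Hom.id
  comp := DeltaWreath.Hom.comp
  id_comp {X Y} f := by
    refine DeltaWreath.Hom.ext' _ _ (Category.id_comp _) fun i j h h' => ?_
    rw [DeltaWreath.Hom.comp_app (DeltaWreath.Hom.id X) f i i j (covers_id i) h' h]
    exact Category.id_comp _
  comp_id {X Y} f := by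
    refine DeltaWreath.Hom.ext' _ _ (Category.comp_id _) fun i j h h' => ?_
    rw [DeltaWreath.Hom.comp_app f (DeltaWreath.Hom.id Y) i j j h' (covers_id j) h]
    exact Category.comp_id _
  assoc {W X Y Z} f g k := by
    refine DeltaWreath.Hom.ext' _ _ (Category.assoc _ _ _) fun i l h h' => ?_
    obtain ⟨c, hc, hl⟩ := Covers.exists_mid (f := f.base ≫ g.base) (g := k.base) h
    obtain ⟨b, hb, hc'⟩ := hc.exists_mid
    rw [DeltaWreath.Hom.comp_app (DeltaWreath.Hom.comp f g) k i c l hc hl h,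
      DeltaWreath.Hom.comp_app f g i b c hb hc' hc,
      DeltaWreath.Hom.comp_app f (DeltaWreath.Hom.comp g k) i b l hb (hc'.comp hl) h',
      DeltaWreath.Hom.comp_app g k b c l hc' hl, Category.assoc]

/-- A morphism is active (inert) if its base and all its components are. -/
instance DeltaWreath.instActiveInert [ActiveInert D] : ActiveInert (DeltaWreath D) where
  act {X Y} (f : DeltaWreath.Hom X Y) := act f.base ∧ ∀ i j h, act (f.app i j h)
  inert {X Y} (f : DeltaWreath.Hom X Y) := inert f.base ∧ ∀ i j h, inert (f.app i j h)

/-- A small category together with its classes of active and inert morphisms. -/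
structure ActiveInertCat where
  carrier : Type
  [cat : Category.{0} carrier]
  [ai : ActiveInert carrier]

attribute [instance] ActiveInertCat.cat ActiveInertCat.ai

/-- Joyal's category `Θ_n`, with its active and inert morphisms, as the `n`-fold iterated wreath
product of the simplex category: `Θ_0` is the terminal category, `Θ_1` is the simplex category and
`Θ_(n+1)` is the wreath product of the simplex category with `Θ_n`. -/
noncomputable def thetaCat : ℕ → ActiveInertCat
  | 0 => @ActiveInertCat.mk (Discrete PUnit.{1}) _ ⟨fun _ => True, fun _ => True⟩
  | 1 => ⟨SimplexCategory⟩
  | n + 2 => ⟨DeltaWreath (thetaCat (n + 1)).carrier⟩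

abbrev Theta (n : ℕ) : Type := (thetaCat n).carrier

end Theta

end MomentCat

open MomentCat

/-! Call α' a successor of α along f if α' ≤ f_*(α); morphisms of the wreath product have one
component for each such pair. Everything rests on how this relation behaves. A given α' has at most
one predecessor (`El.eq_of_sub_push`), and exactly one if f is active (`El.exists_sub_push`, from
the unit axiom). If f is inert, each α has exactly one successor (`El.push`, `El.eq_push`). If r is
an active retraction of an inert i, the relations of i and r are converse to each other
(`El.sub_push_of_comp_eq_id`, `El.sub_push_retraction`).

Hence the axioms of a moment category can be verified on the base in C and then separately on each
component in D. For instance, in an active/inert factorisation of the base every elementary moment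
of the middle object has one predecessor and one successor, so the component to be factored there is
determined.

If U and V are units, U has the identity as its only elementary moment, and the pair (U, V) is a
unit of the wreath product. Such pairs map actively to every object because one unit V of D serves
all members of the family at once. Active maps between units are invertible, so these standard units
decide unitality and uniqueness.

In the simplex category the inert maps are translations, their retractions are truncations, and [1]
is the only unit. The elementary moments of [m] are its m segments, and the successor relation
becomes `Covers`. The resulting comparison functor is an equivalence that detects active and inert
morphisms. Unitality transfers along it, and induction on n gives the statement for Θ_n. -/

namespace MomentCat

open ActiveInert IsMomentCategory

/-! ### Elementary moments along active, inert and retracting morphisms -/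

section ElementaryMoments

variable {C : Type u₁} [Category.{v₁} C] [ActiveInert C]

lemma El.ext' {A : C} {α β : El A} (h : α.1.1 = β.1.1) : α = β := Subtype.ext (Subtype.ext h)

variable [IsMomentCategory C]

lemma act_of_isIso {X Y : C} (f : X ⟶ Y) [IsIso f] : act f := act_of_iso (asIso f)

lemma inert_of_isIso {X Y : C} (f : X ⟶ Y) [IsIso f] : inert f := inert_of_iso (asIso f)

/-- The elementary moment attached to a splitting over a unit. -/
def El.ofSplit {A U : C} (hU : IsUnitObj U) {r : A ⟶ U} {i : U ⟶ A} (hr : act r) (hi : inert i)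
    (hir : i ≫ r = 𝟙 U) : El A :=
  ⟨⟨r ≫ i, isMoment_of_retraction hr hi hir⟩, U, hU, r, i, hr, hi, rfl⟩

lemma Moment.sub_refl {A : C} (φ : Moment A) : φ.Sub φ := by
  obtain ⟨B, r, i, -, -, hir, e⟩ := φ.exists_split
  unfold Moment.Sub
  rw [← e, Category.assoc, reassoc_of% hir]

lemma El.eq_of_sub {A : C} {α β : El A} (h : α.1.Sub β.1) : α = β :=
  (El.eq_of_sub_push_id (by rwa [push_id])).symm

/-- Composing the inert part with `i` stays inert, so the pushforward splits over the same unit. -/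
lemma push_isElementary {A B : C} {i : A ⟶ B} (hi : inert i) (α : El A) :
    (push i α.1).IsElementary := by
  obtain ⟨U, r, j, hU, hr, hj, -, e⟩ := α.exists_split
  have hji := inert_comp _ _ hj hi
  obtain ⟨s, ⟨hs, hs'⟩, -⟩ := exists_unique_retraction _ hji
  exact ⟨U, hU, s, j ≫ i, hs, hji,
    (push_eq i α.1 hr hj e (act_id U) hji (Category.id_comp _) hs hs').symm⟩

/-- The pushforward of an elementary moment along an inert morphism is elementary. -/
noncomputable def El.push {A B : C} {i : A ⟶ B} (hi : inert i) (α : El A) : El B :=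
  ⟨MomentCat.push i α.1, push_isElementary hi α⟩

lemma El.push_sub {A B : C} {i : A ⟶ B} (hi : inert i) (α : El A) :
    (El.push hi α).1.Sub (MomentCat.push i α.1) := Moment.sub_refl _

lemma El.eq_push {A B : C} {i : A ⟶ B} (hi : inert i) {α : El A} {β : El B}
    (h : β.1.Sub (MomentCat.push i α.1)) : β = El.push hi α :=
  El.eq_of_sub (β := El.push hi α) h

/-- Active morphisms pull elementary moments back. -/
lemma El.exists_sub_push {A B : C} {f : A ⟶ B} (hf : act f) (γ : El B) :
    ∃ α : El A, γ.1.Sub (MomentCat.push f α.1) := by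
  obtain ⟨W, s, j, hW, hs, hj, hjs, e⟩ := γ.exists_split
  have hfs := act_comp _ _ hf hs
  -- The inert section of the active map `f ≫ s` to the unit `W` splits the required moment of `A`.
  obtain ⟨l, ⟨hl, hl'⟩, -⟩ := hW.2 A (f ≫ s) hfs
  obtain ⟨E, a, b, ha, hb, eab⟩ := exists_fac (l ≫ f)
  obtain ⟨z, ⟨hz, hz'⟩, -⟩ := exists_unique_retraction b hb
  have habs : a ≫ b ≫ s = 𝟙 W := by rw [reassoc_of% eab]; exact hl'
  have hbs : act (b ≫ s) := act_of_act_comp ha (by rw [habs]; exact act_id W)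
  -- Uniqueness of inert sections of `s` makes `j` factor through the inert part `b` of `l ≫ f`,
  -- which is the required inequality.
  obtain ⟨c, ⟨hc, hc'⟩, -⟩ := hW.2 E (b ≫ s) hbs
  have hcb : c ≫ b = j :=
    section_unique hW hs (inert_comp _ _ hc hb) hj (by simpa using hc') hjs
  refine ⟨El.ofSplit hW hfs hl hl', ?_⟩
  unfold Moment.Sub
  rw [push_eq f (El.ofSplit hW hfs hl hl').1 hfs hl rfl ha hb eab hz hz', ← e, ← hcb]
  simp only [Category.assoc]
  rw [reassoc_of% hz']

/-- If `r` retracts `i`, then `α ≤ r_*(β)` implies `β ≤ i_*(α)`. -/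
lemma El.sub_push_of_comp_eq_id {A B : C} {i : A ⟶ B} {r : B ⟶ A} (h : i ≫ r = 𝟙 A)
    {α : El A} {β : El B} (hα : α.1.Sub (MomentCat.push r β.1)) :
    β.1.Sub (MomentCat.push i α.1) := by
  -- Some `β'` lies between `α` and itself along `i ≫ r`; as `α` has only one predecessor along `r`,
  -- it is `β`.
  obtain ⟨β', h1, h2⟩ := El.exists_mid i r α α (by rw [h]; exact α.sub_push_id)
  rwa [El.eq_of_sub_push r α β β' hα h2]

/-- If `r` retracts the inert morphism `i`, then `β ≤ i_*(α)` implies `α ≤ r_*(β)`. -/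
lemma El.sub_push_retraction {A B : C} {i : A ⟶ B} {r : B ⟶ A} (hi : inert i) (h : i ≫ r = 𝟙 A)
    {α : El A} {β : El B} (hβ : β.1.Sub (MomentCat.push i α.1)) :
    α.1.Sub (MomentCat.push r β.1) := by
  rw [El.eq_push hi hβ]
  change α.1.Sub (MomentCat.push r (MomentCat.push i α.1))
  rw [← push_comp, h]
  exact α.sub_push_id

/-- The identity of a unit, as an elementary moment. -/
def El.unit {U : C} (hU : IsUnitObj U) : El U :=
  El.ofSplit hU (act_id U) (inert_id U) (Category.comp_id _)

/-- A splitting over a unit gives an active map between units, which is invertible. -/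
lemma El.eq_unit {U : C} (hU : IsUnitObj U) (α : El U) : α = El.unit hU := by
  obtain ⟨W, r, i, hW, hr, hi, hir, e⟩ := α.exists_split
  obtain ⟨w, rfl⟩ := exists_iso_of_act hU hW hr
  refine El.ext' ?_
  have : i = w.inv := by rw [← cancel_mono w.hom, hir, w.inv_hom_id]
  rw [← e, this]
  simp [El.unit, El.ofSplit]

/-- The identity moment pushes forward along `φ` to `φ` itself, and the identity lies below `φ` only
if `φ` is the identity. Consequently an endomorphism of a standard unit whose base is a non-identity
moment has no components at all. -/
lemma El.not_sub_push {U : C} (hU : IsUnitObj U) (φ : Moment U) (hφ : φ.1 ≠ 𝟙 U) (α β : El U) :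
    ¬ β.1.Sub (MomentCat.push φ.1 α.1) := by
  intro h
  obtain ⟨A, r, i, hr, hi, hir, e⟩ := φ.exists_split
  rw [El.eq_unit hU α, El.eq_unit hU β] at h
  unfold Moment.Sub at h
  rw [push_eq φ.1 (El.unit hU).1 (act_id U) (inert_id U) rfl hr hi (by simp [e]) hr hir, e] at h
  exact hφ (by simpa [El.unit, El.ofSplit] using h)

end ElementaryMoments

/-! ### The wreath product is a moment category -/

section WreathMoment

variable {C : Type u₁} [Category.{v₁} C] [ActiveInert C] [IsMomentCategory C]
  {D : Type u₂} [Category.{v₂} D]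

lemma Wreath.comp_app {X Y Z : Wreath C D} (f : X ⟶ Y) (g : Y ⟶ Z)
    {α : El X.base} {β : El Y.base} {γ : El Z.base} (h₁ : β.1.Sub (push (Hom.base f) α.1))
    (h₂ : γ.1.Sub (push (Hom.base g) β.1)) (h : γ.1.Sub (push (Hom.base (f ≫ g)) α.1)) :
    Hom.app (f ≫ g) α γ h = Hom.app f α β h₁ ≫ Hom.app g β γ h₂ :=
  Hom.comp_app f g α β γ h₁ h₂ h

/-- Keeping `k` separate from `f ≫ g` lets an equation of morphisms be read componentwise without
rewriting inside the dependent inequality proofs. -/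
lemma Wreath.app_comp_app {X Y Z : Wreath C D} {f : X ⟶ Y} {g : Y ⟶ Z} {k : X ⟶ Z}
    (e : f ≫ g = k) {α : El X.base} {β : El Y.base} {γ : El Z.base}
    (h₁ : β.1.Sub (push (Hom.base f) α.1)) (h₂ : γ.1.Sub (push (Hom.base g) β.1))
    (h : γ.1.Sub (push (Hom.base k) α.1)) :
    Hom.app f α β h₁ ≫ Hom.app g β γ h₂ = Hom.app k α γ h := by
  subst e
  exact (Wreath.comp_app f g h₁ h₂ h).symm

lemma Wreath.hom_ext {X Y : Wreath C D} {f g : X ⟶ Y} (hb : Hom.base f = Hom.base g)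
    (ha : ∀ α β h h', Hom.app f α β h = Hom.app g α β h') : f = g := Hom.ext' f g hb ha

/-- To be an identity can be checked on the base and on the diagonal components. -/
lemma Wreath.eq_id {X : Wreath C D} {f : X ⟶ X} (hb : Hom.base f = 𝟙 X.base)
    (ha : ∀ α h, Hom.app f α α h = 𝟙 (X.fam α)) : f = 𝟙 X := by
  refine Wreath.hom_ext hb fun α β h h' => ?_
  obtain rfl := El.eq_of_sub_push_id h'
  exact ha _ _

/-- If `f ≫ g = 𝟙`, the corresponding components compose to an identity. -/
lemma Wreath.app_comp_app_of_eq_id {X Y : Wreath C D} {f : X ⟶ Y} {g : Y ⟶ X} (e : f ≫ g = 𝟙 X)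
    {α : El X.base} {β : El Y.base} (h : β.1.Sub (push (Hom.base f) α.1))
    (h' : α.1.Sub (push (Hom.base g) β.1)) : Hom.app f α β h ≫ Hom.app g β α h' = 𝟙 _ :=
  Wreath.app_comp_app e h h' α.sub_push_id

def Wreath.baseIso {X Y : Wreath C D} (f : X ≅ Y) : X.base ≅ Y.base :=
  ⟨Hom.base f.hom, Hom.base f.inv, congrArg Hom.base f.hom_inv_id, congrArg Hom.base f.inv_hom_id⟩

def Wreath.appIso {X Y : Wreath C D} (f : X ≅ Y) (α : El X.base) (β : El Y.base)
    (h : β.1.Sub (push (Hom.base f.hom) α.1)) : X.fam α ≅ Y.fam β :=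
  have h' : α.1.Sub (push (Hom.base f.inv) β.1) :=
    El.sub_push_of_comp_eq_id (congrArg Hom.base f.inv_hom_id) h
  ⟨Hom.app f.hom α β h, Hom.app f.inv β α h', app_comp_app_of_eq_id f.hom_inv_id _ _,
    app_comp_app_of_eq_id f.inv_hom_id _ _⟩

/-- A morphism whose base and components are invertible is invertible. -/
lemma Wreath.isIso_of_isIso {X Y : Wreath C D} (f : X ⟶ Y) [IsIso (Hom.base f)]
    [∀ α β h, IsIso (Hom.app f α β h)] : IsIso f := by
  have e : Hom.base f ≫ inv (Hom.base f) = 𝟙 _ := IsIso.hom_inv_id _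
  have e' : inv (Hom.base f) ≫ Hom.base f = 𝟙 _ := IsIso.inv_hom_id _
  let g : Y ⟶ X := (⟨inv (Hom.base f), fun β α h =>
    inv (Hom.app f α β (El.sub_push_of_comp_eq_id e h))⟩ : Wreath.Hom Y X)
  refine ⟨g, ?_, ?_⟩
  · refine Wreath.eq_id e fun α h => ?_
    obtain ⟨β, h1, h2⟩ := El.exists_mid _ _ _ _ h
    rw [Wreath.comp_app f g h1 h2 h]
    exact IsIso.hom_inv_id _
  · refine Wreath.eq_id e' fun α h => ?_
    obtain ⟨β, h1, h2⟩ := El.exists_mid _ _ _ _ h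
    rw [Wreath.comp_app g f h1 h2 h]
    exact IsIso.inv_hom_id _

variable [ActiveInert D] [IsMomentCategory D]

/-- After factoring the base through `E`, each `ε` in `El E` has a unique predecessor `p ε` and a
unique successor `El.push hi ε`. The component of `f` at this pair is factored in `D`, and its
middle object becomes the member of the new family at `ε`. -/
lemma Wreath.exists_fac {X Y : Wreath C D} (f : X ⟶ Y) :
    ∃ (Z : Wreath C D) (a : X ⟶ Z) (i : Z ⟶ Y), act a ∧ inert i ∧ a ≫ i = f := by
  obtain ⟨E, a, i, ha, hi, e⟩ := IsMomentCategory.exists_fac (Hom.base f)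
  choose p hp using El.exists_sub_push ha
  have key : ∀ ε : El E, (El.push hi ε).1.Sub (push (Hom.base f) (p ε).1) := fun ε => by
    rw [← e]
    exact El.sub_push_comp (hp ε) (El.push_sub hi ε)
  choose Z b j hb hj hbj using fun ε => IsMomentCategory.exists_fac (Hom.app f _ _ (key ε))
  -- The `eqToHom` identifies an arbitrary predecessor of `ε` with the chosen `p ε`; in `G` it does
  -- the same for successors.
  let F : X ⟶ ⟨E, Z⟩ := (⟨a, fun α ε h =>
    eqToHom (congrArg X.fam (El.eq_of_sub_push a ε _ _ h (hp ε))) ≫ b ε⟩ : Wreath.Hom X ⟨E, Z⟩)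
  let G : (⟨E, Z⟩ : Wreath C D) ⟶ Y := (⟨i, fun ε β h =>
    j ε ≫ eqToHom (congrArg Y.fam (El.eq_push hi h).symm)⟩ : Wreath.Hom ⟨E, Z⟩ Y)
  refine ⟨⟨E, Z⟩, F, G, ⟨ha, fun α ε h => act_comp _ _ (act_of_isIso _) (hb ε)⟩,
    ⟨hi, fun ε β h => inert_comp _ _ (hj ε) (inert_of_isIso _)⟩, ?_⟩
  refine Wreath.hom_ext e fun α β h h' => ?_
  obtain ⟨ε, h1, h2⟩ := El.exists_mid a i _ _ h
  rw [Wreath.comp_app F G h1 h2 h]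
  obtain rfl := El.eq_of_sub_push a ε _ _ h1 (hp ε)
  obtain rfl := El.eq_push hi h2
  simp [F, G, hbj]

lemma Wreath.fac_unique {X Y Z Z' : Wreath C D} (a : X ⟶ Z) (i : Z ⟶ Y) (a' : X ⟶ Z')
    (i' : Z' ⟶ Y) (ha : act a) (hi : inert i) (ha' : act a') (hi' : inert i')
    (e : a ≫ i = a' ≫ i') : ∃! h : Z ≅ Z', a ≫ h.hom = a' ∧ h.hom ≫ i' = i := by
  obtain ⟨k, ⟨hk, hk'⟩, hku⟩ := IsMomentCategory.fac_unique (Hom.base a) (Hom.base i)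
    (Hom.base a') (Hom.base i') ha.1 hi.1 ha'.1 hi'.1 (congrArg Hom.base e)
  -- Only one `α` and one `β` are related to `ζ` and `ζ'`, so uniqueness in `D` yields the
  -- isomorphism. Quantifying over all of them keeps the conditions free of choices.
  have key : ∀ (ζ : El Z.base) (ζ' : El Z'.base), ζ'.1.Sub (push k.hom ζ.1) →
      ∃! l : Z.fam ζ ≅ Z'.fam ζ', (∀ α h h', Hom.app a α ζ h ≫ l.hom = Hom.app a' α ζ' h') ∧
        (∀ β h h', l.hom ≫ Hom.app i' ζ' β h' = Hom.app i ζ β h) := by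
    intro ζ ζ' hζ
    obtain ⟨α, hα⟩ := El.exists_sub_push ha.1 ζ
    have hα' : ζ'.1.Sub (push (Hom.base a') α.1) := hk ▸ El.sub_push_comp hα hζ
    have hβ := El.push_sub hi'.1 ζ'
    have hβ' : (El.push hi'.1 ζ').1.Sub (push (Hom.base i) ζ.1) := hk' ▸ El.sub_push_comp hζ hβ
    obtain ⟨l, ⟨hl, hl'⟩, hlu⟩ := IsMomentCategory.fac_unique (Hom.app a α ζ hα)
      (Hom.app i ζ _ hβ') (Hom.app a' α ζ' hα') (Hom.app i' ζ' _ hβ) (ha.2 _ _ _) (hi.2 _ _ _)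
      (ha'.2 _ _ _) (hi'.2 _ _ _)
        ((Wreath.app_comp_app e hα hβ' (El.sub_push_comp hα' hβ)).trans
          (Wreath.comp_app a' i' hα' hβ _))
    refine ⟨l, ⟨fun α₁ h h' => ?_, fun β₁ h h' => ?_⟩, fun m hm => hlu m ⟨hm.1 _ _ _, hm.2 _ _ _⟩⟩
    · obtain rfl := El.eq_of_sub_push _ _ _ _ h hα
      exact hl
    · obtain rfl := El.eq_push hi'.1 h'
      exact hl'
  choose l hl hlu using key
  let K : Z ⟶ Z' := (⟨k.hom, fun ζ ζ' h => (l ζ ζ' h).hom⟩ : Wreath.Hom Z Z')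
  have hKb : IsIso (Hom.base K) := inferInstanceAs (IsIso k.hom)
  have hKa : ∀ ζ ζ' h, IsIso (Hom.app K ζ ζ' h) := fun ζ ζ' h =>
    inferInstanceAs (IsIso (l ζ ζ' h).hom)
  have hK : IsIso K := Wreath.isIso_of_isIso K
  refine ⟨asIso K, ⟨?_, ?_⟩, ?_⟩
  · refine Wreath.hom_ext hk fun α ζ' h h' => ?_
    obtain ⟨ζ, h1, h2⟩ := El.exists_mid _ _ _ _ h
    refine (Wreath.comp_app a K h1 h2 h).trans ?_
    exact (hl ζ ζ' h2).1 _ _ _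
  · refine Wreath.hom_ext hk' fun ζ β h h' => ?_
    obtain ⟨ζ', h1, h2⟩ := El.exists_mid _ _ _ _ h
    refine (Wreath.comp_app K i' h1 h2 h).trans ?_
    exact (hl ζ ζ' h1).2 _ _ _
  · rintro M ⟨hM, hM'⟩
    have hMb : Wreath.baseIso M = k := hku _ ⟨congrArg Hom.base hM, congrArg Hom.base hM'⟩
    refine Iso.ext (Wreath.hom_ext (congrArg Iso.hom hMb) fun ζ ζ' h h' => ?_)
    have : Wreath.appIso M ζ ζ' h = l ζ ζ' h' := by
      refine hlu _ _ _ _ ⟨fun α h1 h2 => ?_, fun β h1 h2 => ?_⟩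
      · exact Wreath.app_comp_app hM _ _ _
      · exact Wreath.app_comp_app hM' _ _ _
    exact congrArg Iso.hom this

instance Wreath.instIsMomentCategory : IsMomentCategory (Wreath C D) where
  act_of_iso h := ⟨act_of_iso (Wreath.baseIso h), fun α β hαβ =>
    act_of_iso (Wreath.appIso h α β hαβ)⟩
  inert_of_iso h := ⟨inert_of_iso (Wreath.baseIso h), fun α β hαβ =>
    inert_of_iso (Wreath.appIso h α β hαβ)⟩
  act_comp f g hf hg := ⟨act_comp _ _ hf.1 hg.1, fun α γ h => by
    obtain ⟨β, h1, h2⟩ := El.exists_mid _ _ _ _ h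
    have := act_comp _ _ (hf.2 _ _ h1) (hg.2 _ _ h2)
    rwa [← Wreath.comp_app f g h1 h2 h] at this⟩
  inert_comp f g hf hg := ⟨inert_comp _ _ hf.1 hg.1, fun α γ h => by
    obtain ⟨β, h1, h2⟩ := El.exists_mid _ _ _ _ h
    have := inert_comp _ _ (hf.2 _ _ h1) (hg.2 _ _ h2)
    rwa [← Wreath.comp_app f g h1 h2 h] at this⟩
  exists_fac := Wreath.exists_fac
  fac_unique := Wreath.fac_unique
  exists_unique_retraction {X Y} i hi := by
    obtain ⟨r, ⟨hr, hir⟩, hru⟩ := exists_unique_retraction (Hom.base i) hi.1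
    -- The pairs related by `r` are those related by `i`, reversed, so each component of the
    -- retraction must retract a component of `i`.
    choose s hs hsu using fun (β : El Y.base) (α : El X.base)
      (h : α.1.Sub (push r β.1)) => exists_unique_retraction
        (Hom.app i α β (El.sub_push_of_comp_eq_id hir h)) (hi.2 _ _ _)
    let R : Y ⟶ X := (⟨r, s⟩ : Wreath.Hom Y X)
    refine ⟨R, ⟨⟨hr, fun β α h => (hs β α h).1⟩, Wreath.eq_id hir fun α h => ?_⟩, ?_⟩
    · obtain ⟨β, h1, h2⟩ := El.exists_mid _ _ _ _ h
      exact (Wreath.comp_app i R h1 h2 h).trans (hs β α h2).2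
    · rintro T ⟨hT, hiT⟩
      refine Wreath.hom_ext (hru _ ⟨hT.1, congrArg Hom.base hiT⟩) fun β α h h' => ?_
      exact hsu β α h' _ ⟨hT.2 _ _ _, Wreath.app_comp_app_of_eq_id hiT _ _⟩
  eq_retraction_comp {X Y Z} i f g r hi hf hg hr hir hif := by
    have hb := eq_retraction_comp _ _ _ _ hi.1 hf.1 hg.1 hr.1 (congrArg Hom.base hir)
      (congrArg Hom.base hif)
    refine Wreath.hom_ext hb fun β γ h h' => ?_
    obtain ⟨α, h1, h2⟩ := El.exists_mid _ _ _ _ h'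
    rw [Wreath.comp_app r g h1 h2 h']
    have h3 := El.sub_push_of_comp_eq_id (congrArg Hom.base hir) h1
    refine eq_retraction_comp (Hom.app i α β h3) _ _ _ (hi.2 _ _ _) (hf.2 _ _ _)
      (hg.2 _ _ _) (hr.2 _ _ _) (Wreath.app_comp_app_of_eq_id hir _ _) ?_
    exact Wreath.app_comp_app hif _ _ _

end WreathMoment

/-! ### Reduction to standard units -/

section Units

variable {C : Type u₁} [Category.{v₁} C] [ActiveInert C] [IsMomentCategory C]

/-- Unitality can be checked on a class of standard units. -/
theorem isUnital_of_standard (Std : C → Prop) (hStd : ∀ U, Std U → IsUnitObj U)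
    (hex : ∀ A : C, ∃ (U : C) (φ : U ⟶ A), Std U ∧ act φ)
    (huniq : ∀ {A U U' : C} (φ : U ⟶ A) (φ' : U' ⟶ A), Std U → Std U' → act φ → act φ' →
      ∃! h : U ≅ U', h.hom ≫ φ' = φ) : IsUnital C where
  exists_unit A := by
    obtain ⟨U, φ, hU, hφ⟩ := hex A
    exact ⟨U, φ, hStd U hU, hφ⟩
  unit_unique {A U U'} φ φ' hU hU' hφ hφ' := by
    obtain ⟨S, f, hS, hf⟩ := hex U
    obtain ⟨S', f', hS', hf'⟩ := hex U'
    -- Active maps between units are invertible, so `U` is isomorphic to a standard unit.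
    obtain ⟨k, rfl⟩ := exists_iso_of_act (hStd S hS) hU hf
    obtain ⟨k', rfl⟩ := exists_iso_of_act (hStd S' hS') hU' hf'
    obtain ⟨h, hh, hu⟩ := huniq (k.hom ≫ φ) (k'.hom ≫ φ') hS hS' (act_comp _ _ hf hφ)
      (act_comp _ _ hf' hφ')
    refine ⟨k.symm ≪≫ h ≪≫ k', by simp [hh], fun m hm => ?_⟩
    rw [← hu (k ≪≫ m ≪≫ k'.symm) (by simp [hm])]
    ext
    simp

/-- Essential uniqueness of the unit can be checked on a class of standard units. -/
theorem hasEssentiallyUniqueUnit_of_standard (Std : C → Prop) (hStd : ∀ U, Std U → IsUnitObj U)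
    (hne : ∃ U, Std U) (hex : ∀ A : C, ∃ (U : C) (φ : U ⟶ A), Std U ∧ act φ)
    (huniq : ∀ U U' : C, Std U → Std U' → Nonempty (Unique (U ≅ U'))) :
    HasEssentiallyUniqueUnit C := by
  refine ⟨hne.imp hStd, fun U U' hU hU' => ?_⟩
  obtain ⟨S, f, hS, hf⟩ := hex U
  obtain ⟨S', f', hS', hf'⟩ := hex U'
  obtain ⟨k, rfl⟩ := exists_iso_of_act (hStd S hS) hU hf
  obtain ⟨k', rfl⟩ := exists_iso_of_act (hStd S' hS') hU' hf'
  obtain ⟨h⟩ := huniq S S' hS hS'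
  refine ⟨⟨⟨k.symm ≪≫ default ≪≫ k'⟩, fun m => ?_⟩⟩
  rw [← h.uniq (k ≪≫ m ≪≫ k'.symm)]
  ext
  simp

end Units

/-! ### Units of the wreath product -/

section WreathUnits

variable {C : Type u₁} [Category.{v₁} C] [ActiveInert C] [IsMomentCategory C]
  {D : Type u₂} [Category.{v₂} D]

/-- The object of the wreath product with a constant family. -/
def Wreath.const (U : C) (V : D) : Wreath C D := ⟨U, fun _ => V⟩

/-- A morphism between constant families. -/
def Wreath.constMap {U U' : C} {V V' : D} (f : U ⟶ U') (w : V ⟶ V') :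
    Wreath.const U V ⟶ Wreath.const U' V' :=
  (⟨f, fun _ _ _ => w⟩ : Wreath.Hom (Wreath.const U V) (Wreath.const U' V'))

lemma Wreath.constMap_id (U : C) (V : D) : constMap (𝟙 U) (𝟙 V) = 𝟙 (const U V) :=
  Wreath.eq_id rfl fun _ _ => rfl

lemma Wreath.constMap_comp {U U' U'' : C} {V V' V'' : D} (f : U ⟶ U') (f' : U' ⟶ U'')
    (w : V ⟶ V') (w' : V' ⟶ V'') :
    constMap f w ≫ constMap f' w' = constMap (f ≫ f') (w ≫ w') := by
  refine Wreath.hom_ext rfl fun α γ h h' => ?_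
  obtain ⟨β, h1, h2⟩ := El.exists_mid f f' α γ h
  exact Wreath.comp_app _ _ h1 h2 h

def Wreath.constIso {U U' : C} {V V' : D} (f : U ≅ U') (w : V ≅ V') :
    Wreath.const U V ≅ Wreath.const U' V' where
  hom := constMap f.hom w.hom
  inv := constMap f.inv w.inv
  hom_inv_id := by rw [constMap_comp, f.hom_inv_id, w.hom_inv_id, constMap_id]
  inv_hom_id := by rw [constMap_comp, f.inv_hom_id, w.inv_hom_id, constMap_id]

variable [ActiveInert D] [IsMomentCategory D]

lemma Wreath.isMoment_constMap {U : C} {V : D} (φ : Moment U) (w : Moment V) :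
    IsMoment (constMap φ.1 w.1) := by
  obtain ⟨A, r, i, hr, hi, hir, e⟩ := φ.exists_split
  obtain ⟨B, s, j, hs, hj, hjs, e'⟩ := w.exists_split
  rw [← e, ← e', ← constMap_comp]
  refine isMoment_of_retraction ⟨hr, fun _ _ _ => hs⟩ ⟨hi, fun _ _ _ => hj⟩ ?_
  rw [constMap_comp, hir, hjs, constMap_id]

lemma Wreath.isMoment_base {X : Wreath C D} (Φ : Moment X) : IsMoment (Hom.base Φ.1) := by
  obtain ⟨Z, r, i, hr, hi, hir, e⟩ := Φ.exists_split
  rw [← e]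
  exact isMoment_of_retraction hr.1 hi.1 (congrArg Hom.base hir)

lemma Wreath.isMoment_app {X : Wreath C D} (Φ : Moment X) (α : El X.base)
    (h : α.1.Sub (push (Hom.base Φ.1) α.1)) : IsMoment (Hom.app Φ.1 α α h) := by
  obtain ⟨Z, r, i, hr, hi, hir, e⟩ := Φ.exists_split
  obtain ⟨ζ, h1, h2⟩ := El.exists_mid (Hom.base r) (Hom.base i) α α (by
    rw [← congrArg Hom.base e] at h
    exact h)
  rw [← Wreath.app_comp_app e h1 h2 h]
  exact isMoment_of_retraction (hr.2 _ _ _) (hi.2 _ _ _) (Wreath.app_comp_app_of_eq_id hir _ _)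

def idMoment (A : C) : Moment A :=
  ⟨𝟙 A, by simpa using isMoment_of_retraction (act_id A) (inert_id A) (Category.comp_id _)⟩

/-- If the base of a non-identity moment is the identity, the moment amounts to a non-identity
moment of `V` at the one elementary moment of `U`. Otherwise it has no components and amounts to a
non-identity moment of `U`. In both cases a distinct congruent moment of `V` or `U` lifts by
`constMap`. -/
lemma Wreath.isPrimitive_const {U : C} {V : D} (hU : IsUnitObj U) (hV : IsUnitObj V) :
    IsPrimitive (Wreath.const U V) := by
  constructor
  · obtain ⟨φ, hφ⟩ := hU.1.1
    exact ⟨⟨_, isMoment_constMap φ (idMoment V)⟩, fun h => hφ (congrArg Hom.base h)⟩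
  · intro Φ hΦ hc
    by_cases hb : Hom.base Φ.1 = 𝟙 U
    · have hω : (El.unit hU).1.Sub (push (Hom.base Φ.1) (El.unit hU).1) := by
        rw [hb]
        exact El.sub_push_id _
      let v : Moment V := ⟨_, isMoment_app Φ (El.unit hU) hω⟩
      have hΦv : Φ.1 = constMap (𝟙 U) v.1 := by
        refine Wreath.hom_ext hb fun α β h h' => ?_
        obtain rfl := El.eq_unit hU α
        obtain rfl := El.eq_unit hU β
        rfl
      have hv : v.1 ≠ 𝟙 V := fun h => hΦ (by rw [hΦv, h, constMap_id])
      obtain ⟨w, ⟨h1, h2⟩, hwv⟩ : ∃ w : Moment V, v.Congr w ∧ w ≠ v := by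
        have := hV.1.2 v hv
        unfold Moment.Centric at this
        push Not at this
        exact this
      have := hc ⟨_, isMoment_constMap (idMoment U) w⟩ ⟨by
        rw [hΦv]
        change _ = constMap (𝟙 U) v.1 ≫ constMap (𝟙 U) w.1 ≫ constMap (𝟙 U) v.1
        rw [constMap_comp, constMap_comp, ← h1, Category.comp_id, Category.comp_id], by
        rw [hΦv]
        change constMap (𝟙 U) w.1 =
          constMap (𝟙 U) w.1 ≫ constMap (𝟙 U) v.1 ≫ constMap (𝟙 U) w.1
        rw [constMap_comp, constMap_comp, ← h2, Category.comp_id, Category.comp_id]⟩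
      refine hwv (Subtype.ext ?_)
      have h3 : constMap (𝟙 U) w.1 = constMap (𝟙 U) v.1 := (congrArg Subtype.val this).trans hΦv
      -- Composing with the identity turns `h3` into an equation between the components at the unit.
      have := Wreath.app_comp_app ((Category.comp_id _).trans h3)
        (El.sub_push_id (El.unit hU)) (El.sub_push_id (El.unit hU)) (El.sub_push_id (El.unit hU))
      exact (Category.comp_id _).symm.trans this
    · let φ : Moment U := ⟨_, isMoment_base Φ⟩
      obtain ⟨ψ, ⟨h1, h2⟩, hψ⟩ : ∃ ψ : Moment U, φ.Congr ψ ∧ ψ ≠ φ := by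
        have := hU.1.2 φ hb
        unfold Moment.Centric at this
        push Not at this
        exact this
      -- If `ψ` were the identity, `ψ = ψφψ` would make `φ` the identity too, hence equal to `ψ`.
      have hψ1 : ψ.1 ≠ 𝟙 U := by
        intro h
        rw [h] at h2
        exact hψ (Subtype.ext (by rw [h, h2]; simp))
      refine hψ (Subtype.ext ?_)
      refine congrArg (fun x => Hom.base (Subtype.val x))
        (hc ⟨_, isMoment_constMap ψ (idMoment V)⟩ ⟨?_, ?_⟩)
      · exact Wreath.hom_ext h1 fun α β h _ => (El.not_sub_push hU φ hb α β h).elim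
      · exact Wreath.hom_ext h2 fun α β h _ => (El.not_sub_push hU ψ hψ1 α β h).elim

/-- The base section `i` reverses the relation of `f`, so over each pair related by `i` the
corresponding component of `f` is an active map to `V`, and its inert section is the only possible
component. -/
lemma Wreath.isUnitObj_const {U : C} {V : D} (hU : IsUnitObj U) (hV : IsUnitObj V) :
    IsUnitObj (Wreath.const U V) := by
  refine ⟨isPrimitive_const hU hV, fun X f hf => ?_⟩
  obtain ⟨i, ⟨hi, hif⟩, hiu⟩ := hU.2 _ _ hf.1
  choose j hj hju using fun (α : El U) (β : El X.base) (h : β.1.Sub (push i α.1)) =>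
    hV.2 _ _ (hf.2 β α (El.sub_push_retraction hi hif h))
  let I : const U V ⟶ X := (⟨i, j⟩ : Wreath.Hom (const U V) X)
  refine ⟨I, ⟨⟨hi, fun α β h => (hj α β h).1⟩, Wreath.eq_id hif fun α h => ?_⟩, ?_⟩
  · obtain ⟨β, h1, h2⟩ := El.exists_mid _ _ _ _ h
    exact (Wreath.comp_app I f h1 h2 h).trans (hj α β h1).2
  · rintro T ⟨hT, hTf⟩
    refine Wreath.hom_ext (hiu _ ⟨hT.1, congrArg Hom.base hTf⟩) fun α β h h' => ?_
    exact hju α β h' _ ⟨hT.2 _ _ _, Wreath.app_comp_app_of_eq_id hTf _ _⟩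

/-- The objects `(U, V)` with `U` and `V` units. -/
def Wreath.IsStandardUnit (X : Wreath C D) : Prop :=
  ∃ (U : C) (V : D), IsUnitObj U ∧ IsUnitObj V ∧ X = Wreath.const U V

lemma Wreath.IsStandardUnit.isUnitObj (X : Wreath C D) (h : X.IsStandardUnit) : IsUnitObj X := by
  obtain ⟨U, V, hU, hV, rfl⟩ := h
  exact isUnitObj_const hU hV

end WreathUnits

/-! ### Unitality of the wreath product -/

section WreathUnital

variable {C : Type u₁} [Category.{v₁} C] [ActiveInert C] [IsUnital C]
  {D : Type u₂} [Category.{v₂} D] [ActiveInert D] [IsUnital D]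

/-- The units mapping actively to the various members of the family could differ; essential
uniqueness replaces them all by one `V`. -/
lemma Wreath.exists_standardUnit (hD : HasEssentiallyUniqueUnit D) (X : Wreath C D) :
    ∃ (U : Wreath C D) (φ : U ⟶ X), U.IsStandardUnit ∧ act φ := by
  obtain ⟨U, φ, hU, hφ⟩ := IsUnital.exists_unit X.base
  obtain ⟨⟨V, hV⟩, hD'⟩ := hD
  have : ∀ α : El X.base, ∃ f : V ⟶ X.fam α, act f := fun α => by
    obtain ⟨W, g, hW, hg⟩ := IsUnital.exists_unit (X.fam α)
    obtain ⟨k⟩ := hD' V W hV hW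
    exact ⟨k.default.hom ≫ g, act_comp _ _ (act_of_iso _) hg⟩
  choose f hf using this
  exact ⟨const U V, (⟨φ, fun _ α _ => f α⟩ : Wreath.Hom (const U V) X), ⟨U, V, hU, hV, rfl⟩,
    hφ, fun _ α _ => hf α⟩

lemma Wreath.standardUnit_unique (hD : HasEssentiallyUniqueUnit D) {X P P' : Wreath C D}
    (φ : P ⟶ X) (φ' : P' ⟶ X) (hP : P.IsStandardUnit) (hP' : P'.IsStandardUnit) (hφ : act φ)
    (hφ' : act φ') : ∃! h : P ≅ P', h.hom ≫ φ' = φ := by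
  obtain ⟨U, V, hU, hV, rfl⟩ := hP
  obtain ⟨U', V', hU', hV', rfl⟩ := hP'
  obtain ⟨h, hh, hhu⟩ := IsUnital.unit_unique (Hom.base φ) (Hom.base φ') hU hU' hφ.1 hφ'.1
  obtain ⟨k, hk⟩ := (hD.2 V V' hV hV').some
  refine ⟨constIso h k.default, ?_, fun m hm => ?_⟩
  · refine Wreath.hom_ext hh fun α γ h1 h2 => ?_
    obtain ⟨β, h3, h4⟩ := El.exists_mid _ _ _ _ h1
    refine (Wreath.comp_app _ φ' h3 h4 h1).trans ?_
    -- The isomorphism `l` over this component depends on the indices, but it equals the only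
    -- isomorphism from `V` to `V'`.
    obtain ⟨l, hl, -⟩ := IsUnital.unit_unique (Hom.app φ α γ h2) (Hom.app φ' β γ h4) hV hV'
      (hφ.2 _ _ _) (hφ'.2 _ _ _)
    rw [← hl, hk l]
    rfl
  · refine Iso.ext (Wreath.hom_ext ?_ fun α β h1 h2 => ?_)
    · exact congrArg Iso.hom (hhu (baseIso m) (congrArg Hom.base hm))
    · exact congrArg Iso.hom (hk (appIso m α β h1))

theorem Wreath.isUnital (hD : HasEssentiallyUniqueUnit D) : IsUnital (Wreath C D) :=
  isUnital_of_standard Wreath.IsStandardUnit Wreath.IsStandardUnit.isUnitObj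
    (exists_standardUnit hD) (standardUnit_unique hD)

theorem Wreath.hasEssentiallyUniqueUnit (hC : HasEssentiallyUniqueUnit C)
    (hD : HasEssentiallyUniqueUnit D) : HasEssentiallyUniqueUnit (Wreath C D) := by
  refine hasEssentiallyUniqueUnit_of_standard Wreath.IsStandardUnit
    Wreath.IsStandardUnit.isUnitObj ?_ (exists_standardUnit hD) ?_
  · obtain ⟨U, hU⟩ := hC.1
    obtain ⟨V, hV⟩ := hD.1
    exact ⟨const U V, U, V, hU, hV, rfl⟩
  · rintro P P' ⟨U, V, hU, hV, rfl⟩ ⟨U', V', hU', hV', rfl⟩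
    obtain ⟨h, hh⟩ := (hC.2 U U' hU hU').some
    obtain ⟨k, hk⟩ := (hD.2 V V' hV hV').some
    refine ⟨⟨⟨constIso h.default k.default⟩, fun m => Iso.ext (Wreath.hom_ext ?_ ?_)⟩⟩
    · exact congrArg Iso.hom (hh (baseIso m))
    · exact fun α β h1 _ => congrArg Iso.hom (hk (appIso m α β h1))

end WreathUnital

/-! ### Transfer along an equivalence -/

section Endo

variable {C : Type u₁} [Category.{v₁} C] {D : Type u₂} [Category.{v₂} D] {F : C ⥤ D} [F.Full]
  [F.Faithful] {X : C} {U : D}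

/-- Transport of endomorphisms along a fully faithful functor and an isomorphism. -/
noncomputable def endoEquiv (w : F.obj X ≅ U) : (X ⟶ X) ≃ (U ⟶ U) where
  toFun φ := w.inv ≫ F.map φ ≫ w.hom
  invFun ψ := F.preimage (w.hom ≫ ψ ≫ w.inv)
  left_inv φ := F.map_injective (by simp)
  right_inv ψ := by simp

lemma endoEquiv_comp (w : F.obj X ≅ U) (φ ψ : X ⟶ X) :
    endoEquiv w (φ ≫ ψ) = endoEquiv w φ ≫ endoEquiv w ψ := by
  simp [endoEquiv]

lemma endoEquiv_id (w : F.obj X ≅ U) : endoEquiv w (𝟙 X) = 𝟙 U := by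
  simp [endoEquiv]

end Endo

section Transfer

variable {C : Type u₁} [Category.{v₁} C] [ActiveInert C]
  {D : Type u₂} [Category.{v₂} D] [ActiveInert D]

/-- The functor `F` preserves and reflects active and inert morphisms. -/
structure DetectsActiveInert (F : C ⥤ D) : Prop where
  act_iff : ∀ {X Y : C} (f : X ⟶ Y), act (F.map f) ↔ act f
  inert_iff : ∀ {X Y : C} (f : X ⟶ Y), inert (F.map f) ↔ inert f

variable {F : C ⥤ D} [F.IsEquivalence]

theorem DetectsActiveInert.isMomentCategory (hF : DetectsActiveInert F) [IsMomentCategory D] :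
    IsMomentCategory C where
  act_of_iso h := (hF.act_iff _).1 (act_of_iso (F.mapIso h))
  inert_of_iso h := (hF.inert_iff _).1 (inert_of_iso (F.mapIso h))
  act_comp f g hf hg := by
    rw [← hF.act_iff] at *
    rw [F.map_comp]
    exact act_comp _ _ hf hg
  inert_comp f g hf hg := by
    rw [← hF.inert_iff] at *
    rw [F.map_comp]
    exact inert_comp _ _ hf hg
  exists_fac f := by
    obtain ⟨Z, a, i, ha, hi, e⟩ := exists_fac (F.map f)
    let w := F.objObjPreimageIso Z
    refine ⟨F.objPreimage Z, F.preimage (a ≫ w.inv), F.preimage (w.hom ≫ i), ?_, ?_, ?_⟩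
    · rw [← hF.act_iff, F.map_preimage]
      exact act_comp _ _ ha (act_of_iso w.symm)
    · rw [← hF.inert_iff, F.map_preimage]
      exact inert_comp _ _ (inert_of_iso w) hi
    · apply F.map_injective
      simp [e]
  fac_unique a i a' i' ha hi ha' hi' e := by
    rw [← hF.act_iff] at ha ha'
    rw [← hF.inert_iff] at hi hi'
    obtain ⟨k, ⟨h1, h2⟩, hu⟩ := fac_unique _ _ _ _ ha hi ha' hi'
      (by rw [← F.map_comp, ← F.map_comp, e])
    refine ⟨F.preimageIso k, ⟨F.map_injective ?_, F.map_injective ?_⟩, fun m hm => ?_⟩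
    · simpa using h1
    · simpa using h2
    · rw [← hu (F.mapIso m) ⟨by rw [← hm.1]; simp, by rw [← hm.2]; simp⟩]
      ext
      simp
  exists_unique_retraction i hi := by
    obtain ⟨r, ⟨hr, hir⟩, hu⟩ := exists_unique_retraction (F.map i) ((hF.inert_iff _).2 hi)
    refine ⟨F.preimage r, ⟨?_, F.map_injective ?_⟩, fun s hs => F.map_injective ?_⟩
    · rwa [← hF.act_iff, F.map_preimage]
    · simpa using hir
    · rw [F.map_preimage]
      exact hu _ ⟨(hF.act_iff _).2 hs.1, by rw [← F.map_comp, hs.2, F.map_id]⟩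
  eq_retraction_comp i f g r hi hf hg hr hir hif := by
    apply F.map_injective
    rw [F.map_comp]
    refine eq_retraction_comp (F.map i) _ _ _ ((hF.inert_iff _).2 hi) ((hF.act_iff _).2 hf)
      ((hF.act_iff _).2 hg) ((hF.act_iff _).2 hr) ?_ ?_
    · rw [← F.map_comp, hir, F.map_id]
    · rw [← F.map_comp, hif]

variable {X : C} {U : D}

lemma DetectsActiveInert.exists_unit (hF : DetectsActiveInert F) [IsUnital D] (A : C) :
    ∃ (X : C) (φ : X ⟶ A), (∃ U : D, IsUnitObj U ∧ Nonempty (F.obj X ≅ U)) ∧ act φ := by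
  obtain ⟨U, φ, hU, hφ⟩ := IsUnital.exists_unit (F.obj A)
  let w := F.objObjPreimageIso U
  refine ⟨F.objPreimage U, F.preimage (w.hom ≫ φ), ⟨U, hU, ⟨w⟩⟩, ?_⟩
  rw [← hF.act_iff, F.map_preimage]
  exact act_comp _ _ (act_of_iso w) hφ

variable [IsMomentCategory C]

lemma DetectsActiveInert.isMoment_endoEquiv [IsMomentCategory D] (hF : DetectsActiveInert F)
    (w : F.obj X ≅ U) {φ : X ⟶ X} (hφ : IsMoment φ) : IsMoment (endoEquiv w φ) := by
  obtain ⟨A, r, i, hr, hi, hir, e⟩ := Moment.exists_split ⟨φ, hφ⟩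
  have : endoEquiv w φ = (w.inv ≫ F.map r) ≫ (F.map i ≫ w.hom) := by
    change w.inv ≫ F.map φ ≫ w.hom = _
    rw [show φ = r ≫ i from e.symm]
    simp
  rw [this]
  refine isMoment_of_retraction (act_comp _ _ (act_of_iso w.symm) ((hF.act_iff _).2 hr))
    (inert_comp _ _ ((hF.inert_iff _).2 hi) (inert_of_iso w)) ?_
  simp [← F.map_comp, hir]

lemma DetectsActiveInert.isMoment_endoEquiv_symm [IsMomentCategory D] (hF : DetectsActiveInert F)
    (w : F.obj X ≅ U) {ψ : U ⟶ U} (hψ : IsMoment ψ) : IsMoment ((endoEquiv w).symm ψ) := by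
  obtain ⟨A, r, i, hr, hi, hir, e⟩ := Moment.exists_split ⟨ψ, hψ⟩
  let z := F.objObjPreimageIso A
  have : (endoEquiv w).symm ψ =
      F.preimage (w.hom ≫ r ≫ z.inv) ≫ F.preimage (z.hom ≫ i ≫ w.inv) := by
    change F.preimage (w.hom ≫ ψ ≫ w.inv) = _
    rw [show ψ = r ≫ i from e.symm]
    apply F.map_injective
    simp
  rw [this]
  refine isMoment_of_retraction ?_ ?_ (F.map_injective ?_)
  · rw [← hF.act_iff, F.map_preimage]
    exact act_comp _ _ (act_of_iso w) (act_comp _ _ hr (act_of_iso z.symm))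
  · rw [← hF.inert_iff, F.map_preimage]
    exact inert_comp _ _ (inert_of_iso z) (inert_comp _ _ hi (inert_of_iso w.symm))
  · simp [reassoc_of% hir]

/-- `endoEquiv` is multiplicative and matches moments, so it matches congruence and centric moments;
inert sections of `f` correspond to those of `F.map f ≫ w.hom`. -/
lemma DetectsActiveInert.isUnitObj [IsMomentCategory D] (hF : DetectsActiveInert F)
    (w : F.obj X ≅ U) (hU : IsUnitObj U) : IsUnitObj X := by
  refine ⟨⟨?_, fun φ hφ hc => ?_⟩, fun Y f hf => ?_⟩
  · obtain ⟨ψ, hψ⟩ := hU.1.1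
    refine ⟨⟨_, hF.isMoment_endoEquiv_symm w ψ.2⟩, fun h => hψ ?_⟩
    rw [← endoEquiv_id w, ← h, Equiv.apply_symm_apply]
  · refine hU.1.2 ⟨_, hF.isMoment_endoEquiv w φ.2⟩ (fun h => hφ ?_) fun ψ hψ => ?_
    · exact (endoEquiv w).injective (h.trans (endoEquiv_id w).symm)
    · have := hc ⟨_, hF.isMoment_endoEquiv_symm w ψ.2⟩
        ⟨(endoEquiv w).injective (by simpa [endoEquiv_comp] using hψ.1),
          (endoEquiv w).injective (by simpa [endoEquiv_comp] using hψ.2)⟩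
      refine Subtype.ext ?_
      exact (Equiv.symm_apply_eq _).1 (congrArg Subtype.val this)
  · obtain ⟨i, ⟨hi, hif⟩, hu⟩ := hU.2 _ (F.map f ≫ w.hom)
      (act_comp _ _ ((hF.act_iff _).2 hf) (act_of_iso w))
    refine ⟨F.preimage (w.hom ≫ i), ⟨?_, F.map_injective ?_⟩, fun j hj => F.map_injective ?_⟩
    · rw [← hF.inert_iff, F.map_preimage]
      exact inert_comp _ _ (inert_of_iso w) hi
    · have : i ≫ F.map f = w.inv := by rw [← cancel_mono w.hom, Category.assoc, hif, w.inv_hom_id]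
      simp [this]
    · rw [F.map_preimage, ← hu (w.inv ≫ F.map j) ⟨inert_comp _ _ (inert_of_iso w.symm)
        ((hF.inert_iff _).2 hj.1), ?_⟩, w.hom_inv_id_assoc]
      simp only [Category.assoc]
      rw [← F.map_comp_assoc, hj.2]
      simp

theorem DetectsActiveInert.isUnital (hF : DetectsActiveInert F) [IsUnital D] : IsUnital C := by
  refine isUnital_of_standard (fun X => ∃ U : D, IsUnitObj U ∧ Nonempty (F.obj X ≅ U))
    (fun X ⟨U, hU, ⟨w⟩⟩ => hF.isUnitObj w hU) hF.exists_unit ?_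
  rintro A X X' φ φ' ⟨U, hU, ⟨w⟩⟩ ⟨U', hU', ⟨w'⟩⟩ hφ hφ'
  obtain ⟨h, hh, hu⟩ := IsUnital.unit_unique (w.inv ≫ F.map φ) (w'.inv ≫ F.map φ') hU hU'
    (act_comp _ _ (act_of_iso w.symm) ((hF.act_iff _).2 hφ))
    (act_comp _ _ (act_of_iso w'.symm) ((hF.act_iff _).2 hφ'))
  refine ⟨F.preimageIso (w ≪≫ h ≪≫ w'.symm), F.map_injective ?_, fun m hm => ?_⟩
  · simp [hh]
  · rw [← hu (w.symm ≪≫ F.mapIso m ≪≫ w') (by simp [← F.map_comp, hm])]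
    ext
    simp

theorem DetectsActiveInert.hasEssentiallyUniqueUnit (hF : DetectsActiveInert F) [IsUnital D]
    (hD : HasEssentiallyUniqueUnit D) : HasEssentiallyUniqueUnit C := by
  refine hasEssentiallyUniqueUnit_of_standard
    (fun X => ∃ U : D, IsUnitObj U ∧ Nonempty (F.obj X ≅ U))
    (fun X ⟨U, hU, ⟨w⟩⟩ => hF.isUnitObj w hU) ?_ hF.exists_unit ?_
  · obtain ⟨U, hU⟩ := hD.1
    exact ⟨F.objPreimage U, U, hU, ⟨F.objObjPreimageIso U⟩⟩
  · rintro X X' ⟨U, hU, ⟨w⟩⟩ ⟨U', hU', ⟨w'⟩⟩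
    obtain ⟨h, hh⟩ := (hD.2 U U' hU hU').some
    refine ⟨⟨⟨F.preimageIso (w ≪≫ h.default ≪≫ w'.symm)⟩, fun m => ?_⟩⟩
    rw [← hh (w.symm ≪≫ F.mapIso m ≪≫ w')]
    ext
    simp

end Transfer

/-! ### The simplex category is a unital moment category -/

section Simplex

open SimplexCategory
open scoped Simplicial

/-- A simplicial operator as a function on natural numbers, extended by its last value. -/
def ev {X Y : SimplexCategory} (f : X ⟶ Y) (x : ℕ) : ℕ :=
  f.toOrderHom ⟨min x X.len, by omega⟩

/-- The simplicial operator given by a monotone function on natural numbers. -/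
def ofNatFun (X Y : SimplexCategory) (h : ℕ → ℕ) (hm : Monotone h) (hb : h X.len ≤ Y.len) :
    X ⟶ Y :=
  SimplexCategory.Hom.mk ⟨fun x => ⟨h x, by have := hm (Nat.lt_succ_iff.1 x.2); omega⟩,
    fun _ _ hxy => hm hxy⟩

variable {X Y Z : SimplexCategory}

lemma ev_coe (f : X ⟶ Y) (x : Fin (X.len + 1)) : ev f x = f.toOrderHom x := by
  have : min (x : ℕ) X.len = x := by omega
  simp only [ev, this]

lemma ev_le (f : X ⟶ Y) (x : ℕ) : ev f x ≤ Y.len := Nat.lt_succ_iff.1 (Fin.is_lt _)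

lemma ev_mono (f : X ⟶ Y) {x y : ℕ} (h : x ≤ y) : ev f x ≤ ev f y :=
  f.toOrderHom.monotone (by simp only [Fin.mk_le_mk]; omega)

lemma ev_id (x : ℕ) : ev (𝟙 X) x = min x X.len := rfl

lemma ev_comp (f : X ⟶ Y) (g : Y ⟶ Z) (x : ℕ) : ev (f ≫ g) x = ev g (ev f x) :=
  (ev_coe g _).symm

lemma ev_ext {f g : X ⟶ Y} (h : ∀ x ≤ X.len, ev f x = ev g x) : f = g := by
  refine SimplexCategory.Hom.ext _ _ (OrderHom.ext _ _ (funext fun x => Fin.ext ?_))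
  rw [← ev_coe, ← ev_coe, h x (by omega)]

lemma act_iff_ev (f : X ⟶ Y) : act f ↔ ev f 0 = 0 ∧ ev f X.len = Y.len := by
  rw [show ev f 0 = f.toOrderHom 0 from ev_coe f 0,
    show ev f X.len = f.toOrderHom (Fin.last _) from ev_coe f (Fin.last _)]
  simp only [act, Fin.ext_iff, Fin.val_last, Fin.val_zero]

lemma inert_iff_ev (f : X ⟶ Y) : inert f ↔ ∀ x ≤ X.len, ev f x = ev f 0 + x := by
  have key : inert f ↔ ∀ x < X.len, ev f (x + 1) = ev f x + 1 := by
    constructor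
    · intro h x hx
      have := h ⟨x, hx⟩
      rwa [← ev_coe, ← ev_coe] at this
    · intro h i
      rw [← ev_coe, ← ev_coe]
      exact h i i.2
  rw [key]
  constructor
  · intro h x
    induction x with
    | zero => simp
    | succ x ih => intro hx; rw [h x (by omega), ih (by omega)]; omega
  · intro h x hx
    rw [h _ (by omega), h x (by omega)]
    omega

lemma covers_iff_ev (f : X ⟶ Y) (i : Fin X.len) (j : Fin Y.len) :
    Covers f i j ↔ ev f i ≤ j ∧ (j : ℕ) + 1 ≤ ev f (i + 1) := by
  rw [show ev f i = f.toOrderHom i.castSucc from ev_coe f i.castSucc,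
    show ev f (i + 1) = f.toOrderHom i.succ from ev_coe f i.succ]
  simp [Covers, Fin.le_def]

/-- The inert morphism `x ↦ a + x`. -/
def shift (X Y : SimplexCategory) (a : ℕ) (h : a + X.len ≤ Y.len) : X ⟶ Y :=
  ofNatFun X Y (fun x => a + x) (fun _ _ hxy => Nat.add_le_add_left hxy a) h

/-- The active morphism `x ↦ min (x - a) k`, for `Y = [k]`. -/
def clamp (X Y : SimplexCategory) (a : ℕ) : X ⟶ Y :=
  ofNatFun X Y (fun x => min (x - a) Y.len) (fun x y hxy => by dsimp only; omega) (by omega)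

lemma ev_shift (a : ℕ) (h : a + X.len ≤ Y.len) (x : ℕ) :
    ev (shift X Y a h) x = a + min x X.len := rfl

lemma ev_clamp (a x : ℕ) : ev (clamp X Y a) x = min (min x X.len - a) Y.len := rfl

lemma inert_shift (a : ℕ) (h : a + X.len ≤ Y.len) : inert (shift X Y a h) := by
  rw [inert_iff_ev]
  intro x hx
  simp only [ev_shift]
  omega

lemma act_clamp (a : ℕ) (h : a + X.len ≤ Y.len) : act (clamp Y X a) := by
  rw [act_iff_ev]
  simp only [ev_clamp]
  omega

lemma shift_clamp (a : ℕ) (h : a + X.len ≤ Y.len) : shift X Y a h ≫ clamp Y X a = 𝟙 X := by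
  refine ev_ext fun x hx => ?_
  simp only [ev_comp, ev_shift, ev_clamp, ev_id]
  omega

lemma shift_bound {f : X ⟶ Y} (hf : inert f) : ev f 0 + X.len ≤ Y.len := by
  rw [← (inert_iff_ev f).1 hf _ le_rfl]
  exact ev_le _ _

lemma eq_shift {f : X ⟶ Y} (hf : inert f) : f = shift X Y (ev f 0) (shift_bound hf) :=
  ev_ext fun x hx => by rw [(inert_iff_ev f).1 hf x hx, ev_shift]; omega

lemma simplex_eq_of_iso (h : X ≅ Y) : X = Y :=
  SimplexCategory.ext (len_eq_of_isIso h.hom)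

/-- The values on the image of the translation are prescribed; by monotonicity those below `a` are
at most 0 and those above `a + X.len` are maximal. -/
lemma eq_clamp {a : ℕ} {h : a + X.len ≤ Y.len} {s : Y ⟶ X}
    (e : shift X Y a h ≫ s = 𝟙 X) : s = clamp Y X a := by
  have key : ∀ y ≤ X.len, ev s (a + y) = y := fun y hy => by
    have := congrArg (fun t => ev t y) e
    simp only [ev_comp, ev_shift, ev_id] at this
    rwa [min_eq_left hy] at this
  refine ev_ext fun x hx => ?_
  rw [ev_clamp, min_eq_left hx]
  rcases le_total x a with h1 | h1
  · have h2 := ev_mono s h1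
    have h3 := key 0 (by omega)
    rw [add_zero] at h3
    omega
  · obtain ⟨y, rfl⟩ := Nat.exists_eq_add_of_le h1
    rcases le_total y X.len with h2 | h2
    · rw [key y h2]
      omega
    · have h3 := ev_mono s (Nat.add_le_add_left h2 a)
      have h4 := ev_le s (a + y)
      have h5 := key X.len le_rfl
      omega

/-- The factorisation is `x ↦ f x - f 0` followed by translation by `f 0`. It is unique because the
values at both endpoints fix the translation and the middle object, and automorphisms are trivial.
-/
lemma simplex_isMomentCategory : IsMomentCategory SimplexCategory where
  act_of_iso h := by
    obtain rfl := simplex_eq_of_iso h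
    rw [iso_eq_iso_refl h]
    exact ⟨rfl, rfl⟩
  inert_of_iso h := by
    obtain rfl := simplex_eq_of_iso h
    rw [iso_eq_iso_refl h]
    exact fun _ => rfl
  act_comp f g hf hg := by
    rw [act_iff_ev] at *
    simp only [ev_comp, hf, hg, and_self]
  inert_comp f g hf hg := by
    have hb := shift_bound hf
    rw [inert_iff_ev] at *
    intro x hx
    simp only [ev_comp]
    rw [hf x hx, hg _ (by omega), hg (ev f 0) (by omega)]
    omega
  exists_fac {X Y} f := by
    have h0 : ev f 0 ≤ ev f X.len := ev_mono f (Nat.zero_le _)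
    have h1 := ev_le f X.len
    let a : X ⟶ ⦋ev f X.len - ev f 0⦌ := ofNatFun _ _ (fun x => ev f x - ev f 0)
      (fun x y hxy => Nat.sub_le_sub_right (ev_mono f hxy) _) le_rfl
    have ha : ∀ x, ev a x = ev f (min x X.len) - ev f 0 := fun _ => rfl
    refine ⟨_, a, shift _ _ (ev f 0) (by simp only; omega), ?_, inert_shift _ _, ?_⟩
    · rw [act_iff_ev, ha, ha]
      simp
    · refine ev_ext fun x hx => ?_
      have h2 : ev f 0 ≤ ev f x := ev_mono f (Nat.zero_le _)
      have h3 : ev f x ≤ ev f X.len := ev_mono f hx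
      rw [ev_comp, ev_shift, ha, min_eq_left hx]
      simp only
      omega
  fac_unique {X Y Z Z'} a i a' i' ha hi ha' hi' e := by
    have he : ∀ x, ev i (ev a x) = ev i' (ev a' x) := fun x => by rw [← ev_comp, ← ev_comp, e]
    rw [act_iff_ev] at ha ha'
    rw [inert_iff_ev] at hi hi'
    have h0 := he 0
    have h1 := he X.len
    rw [ha.1, ha'.1] at h0
    rw [ha.2, ha'.2, hi _ le_rfl, hi' _ le_rfl] at h1
    obtain rfl : Z = Z' := SimplexCategory.ext (by omega)
    obtain rfl : i = i' := ev_ext fun x hx => by rw [hi x hx, hi' x hx, h0]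
    obtain rfl : a = a' := ev_ext fun x hx => by
      have := he x
      rw [hi _ (ev_le _ _), hi _ (ev_le _ _)] at this
      omega
    exact ⟨Iso.refl _, by simp, fun m _ => iso_eq_iso_refl m⟩
  exists_unique_retraction {X Y} i hi := by
    rw [eq_shift hi]
    exact ⟨clamp Y X _, ⟨act_clamp _ (shift_bound hi), shift_clamp _ _⟩,
      fun s hs => eq_clamp hs.2⟩
  eq_retraction_comp {X Y Z} i f g r hi hf hg hr hir hif := by
    obtain ⟨c, hb, rfl⟩ : ∃ c h, i = shift X Y c h := ⟨_, _, eq_shift hi⟩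
    obtain rfl := eq_clamp hir
    subst hif
    rw [act_iff_ev] at hf hg
    simp only [ev_comp, ev_shift] at hg
    refine ev_ext fun x hx => ?_
    simp only [ev_comp, ev_shift, ev_clamp, min_eq_left hx]
    -- Activity of `f` and `g` makes `f` constantly minimal up to `c` and constantly maximal from `c
    -- + X.len` on, which is also where the truncation is constant.
    rcases le_total x c with h1 | h1
    · have h2 := ev_mono f h1
      simp only [Nat.zero_min, add_zero] at hg
      rw [show c + min (min (x - c) X.len) X.len = c by omega]
      omega
    · rcases le_total x (c + X.len) with h2 | h2
      · congr 1
        omega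
      · have h3 := ev_mono f h2
        have h4 := ev_le f x
        have h5 := hg.2
        rw [min_self] at h5
        rw [show c + min (min (x - c) X.len) X.len = c + X.len by omega]
        omega

attribute [local instance] simplex_isMomentCategory

/-- The non-identity endomorphisms are the two constants. A composite of constants is the one
applied last, so they are congruent to each other. An active map to [1] jumps from 0 to 1 exactly
once, and its inert section is the segment where it jumps. -/
lemma isUnitObj_one : IsUnitObj (⦋1⦌ : SimplexCategory) := by
  have hb : ∀ a : Fin 2, (a : ℕ) + (⦋0⦌ : SimplexCategory).len ≤ (⦋1⦌ : SimplexCategory).len :=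
    fun a => by simp only; omega
  let e : Fin 2 → Moment (⦋1⦌ : SimplexCategory) := fun a =>
    ⟨_, isMoment_of_retraction (act_clamp a (hb a)) (inert_shift a (hb a))
      (shift_clamp a (hb a))⟩
  have he : ∀ a x, ev (e a).1 x = a := fun a x => by
    simp only [e, ev_comp, ev_shift, ev_clamp]
    omega
  have hne : ∀ a, (e a).1 ≠ 𝟙 _ := fun a h => by
    have h0 := he a 0
    have h1 := he a 1
    rw [h, ev_id] at h0 h1
    simp only at h0 h1
    omega
  refine ⟨⟨⟨e 0, hne 0⟩, fun φ hφ hc => ?_⟩, fun X f hf => ?_⟩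
  · obtain ⟨a, ha⟩ : ∃ a, φ = e a := by
      have h0 := ev_mono φ.1 zero_le_one
      have h1 := ev_le φ.1 1
      simp only at h1
      have h2 : ev φ.1 0 = ev φ.1 1 := by
        by_contra h
        refine hφ (ev_ext fun x hx => ?_)
        rw [ev_id, min_eq_left hx]
        simp only at hx
        interval_cases x <;> omega
      refine ⟨⟨ev φ.1 1, by omega⟩,
        Subtype.ext (ev_ext fun x hx => (?_ : _ = _).trans (he _ _).symm)⟩
      simp only at hx
      interval_cases x <;> simp [h2]
    have hcong : ∀ a b, (e a).Congr (e b) := fun a b =>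
      ⟨ev_ext fun x _ => by simp only [ev_comp, he], ev_ext fun x _ => by simp only [ev_comp, he]⟩
    subst ha
    -- In `Fin 2`, `1 - a` is the other constant.
    have h := hc (e (1 - a)) (hcong _ _)
    have h1 := he a 0
    rw [← h, he] at h1
    fin_cases a <;> simp at h1
  · rw [act_iff_ev] at hf
    simp only at hf
    obtain ⟨k, hk, hk', hk''⟩ : ∃ k, k + 1 ≤ X.len ∧ ev f k = 0 ∧ ev f (k + 1) = 1 := by
      classical
      -- The jump ends at the least `n` with value 1, so `k` is its predecessor.
      have hex : ∃ n, ev f n = 1 := ⟨_, hf.2⟩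
      have h1 := Nat.find_spec hex
      have h2 := Nat.find_min' hex hf.2
      have h3 : Nat.find hex ≠ 0 := fun h => by rw [h] at h1; omega
      obtain ⟨k, hk⟩ := Nat.exists_eq_succ_of_ne_zero h3
      have h4 := Nat.find_min hex (m := k) (by omega)
      have h5 := ev_le f k
      simp only at h5
      rw [hk] at h1 h2
      exact ⟨k, h2, by omega, h1⟩
    refine ⟨shift _ _ k hk, ⟨inert_shift _ _, ev_ext fun x hx => ?_⟩, fun j hj => ?_⟩
    · simp only at hx
      interval_cases x <;> simpa [ev_comp, ev_shift, ev_id]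
    · rw [eq_shift hj.1]
      have hji := (inert_iff_ev j).1 hj.1 1 le_rfl
      have h0 := congrArg (fun t => ev t 0) hj.2
      have h1 := congrArg (fun t => ev t 1) hj.2
      simp only [ev_comp, ev_id] at h0 h1
      rw [hji] at h1
      have h2 : ev j 0 = k := by
        by_contra hne
        rcases lt_or_gt_of_ne hne with h | h
        · have := ev_mono f (show ev j 0 + 1 ≤ k from h)
          omega
        · have := ev_mono f (show k + 1 ≤ ev j 0 from h)
          omega
      congr 1

lemma exists_act_one (X : SimplexCategory) :
    ∃ (U : SimplexCategory) (φ : U ⟶ X), U = ⦋1⦌ ∧ act φ := by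
  let φ : ⦋1⦌ ⟶ X := ofNatFun _ _ (fun x => x * X.len)
    (fun x y h => Nat.mul_le_mul_right _ h) (by simp)
  have hφ : ∀ x, ev φ x = min x 1 * X.len := fun _ => rfl
  refine ⟨_, φ, rfl, ?_⟩
  rw [act_iff_ev, hφ, hφ]
  simp

theorem simplex_isUnital : IsUnital SimplexCategory := by
  refine isUnital_of_standard (fun U => U = ⦋1⦌) (fun U hU => hU ▸ isUnitObj_one)
    exists_act_one ?_
  rintro A _ _ φ φ' rfl rfl hφ hφ'
  refine ⟨Iso.refl _, ?_, fun m _ => iso_eq_iso_refl m⟩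
  rw [act_iff_ev] at hφ hφ'
  refine ev_ext fun x hx => ?_
  simp only at hx hφ hφ'
  simp only [Iso.refl_hom, Category.id_comp]
  interval_cases x <;> omega

attribute [local instance] simplex_isUnital

lemma simplex_hasEssentiallyUniqueUnit : HasEssentiallyUniqueUnit SimplexCategory :=
  hasEssentiallyUniqueUnit_of_standard (fun U => U = ⦋1⦌) (fun U hU => hU ▸ isUnitObj_one)
    ⟨_, rfl⟩ exists_act_one fun U U' hU hU' => by
      subst hU hU'
      exact ⟨⟨⟨Iso.refl _⟩, iso_eq_iso_refl⟩⟩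

lemma eq_one_of_isUnitObj {U : SimplexCategory} (hU : IsUnitObj U) : U = ⦋1⦌ := by
  obtain ⟨V, f, rfl, hf⟩ := exists_act_one U
  obtain ⟨h, -⟩ := exists_iso_of_act isUnitObj_one hU hf
  exact (simplex_eq_of_iso h).symm

end Simplex

/-! ### Elementary moments of [m] are segments -/

section Segments

attribute [local instance] simplex_isMomentCategory

open SimplexCategory
open scoped Simplicial

variable {X Y : SimplexCategory}

/-- The elementary moment of `[m]` corresponding to the segment `i`. -/
def segment (i : Fin X.len) : El X :=
  have h : (i : ℕ) + (⦋1⦌ : SimplexCategory).len ≤ X.len := i.2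
  El.ofSplit isUnitObj_one (act_clamp i h) (inert_shift i h) (shift_clamp i h)

lemma ev_segment (i : Fin X.len) (x : ℕ) :
    ev (segment i).1.1 x = i + min (min x X.len - i) 1 := by
  have h : (i : ℕ) + (⦋1⦌ : SimplexCategory).len ≤ X.len := i.2
  change ev (clamp X ⦋1⦌ i ≫ shift ⦋1⦌ X i h) x = _
  rw [ev_comp, ev_shift, ev_clamp]
  simp only
  omega

lemma segment_injective : Function.Injective (segment (X := X)) := by
  intro i j h
  have := ev_segment i 0
  rw [h, ev_segment] at this
  exact Fin.ext (by omega)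

lemma segment_surjective : Function.Surjective (segment (X := X)) := by
  intro α
  obtain ⟨U, r, i, hU, hr, hi, hir, e⟩ := α.exists_split
  obtain rfl := eq_one_of_isUnitObj hU
  obtain ⟨c, h, rfl⟩ : ∃ c h, i = shift ⦋1⦌ X c h := ⟨_, _, eq_shift hi⟩
  obtain rfl := eq_clamp hir
  exact ⟨⟨c, h⟩, El.ext' e⟩

/-- Elementary moments of `[m]` are segments. -/
noncomputable def segmentEquiv (X : SimplexCategory) : Fin X.len ≃ El X :=
  Equiv.ofBijective segment ⟨segment_injective, segment_surjective⟩

/-- The pushforward is the truncation onto the interval from `f i` to `f (i + 1)`, and the segment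
`j` lies below it exactly when this truncation fixes `j` and `j + 1`. -/
lemma segment_sub_push (f : X ⟶ Y) (i : Fin X.len) (j : Fin Y.len) :
    (segment j).1.Sub (push f (segment i).1) ↔ Covers f i j := by
  have hi : (i : ℕ) + (⦋1⦌ : SimplexCategory).len ≤ X.len := i.2
  have hab : ev f i ≤ ev f (i + 1) := ev_mono f (Nat.le_succ _)
  have hb := ev_le f (i + 1)
  let f' : ⦋1⦌ ⟶ ⦋ev f (i + 1) - ev f i⦌ := ofNatFun _ _ (fun x => ev f (i + x) - ev f i)
    (fun x y hxy => Nat.sub_le_sub_right (ev_mono f (Nat.add_le_add_left hxy _)) _) le_rfl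
  have hf' : ∀ x, ev f' x = ev f (i + min x 1) - ev f i := fun _ => rfl
  have hk : ev f i + (⦋ev f (i + 1) - ev f i⦌ : SimplexCategory).len ≤ Y.len := by
    simp only
    omega
  have hpush : (push f (segment i).1).1 = clamp Y _ (ev f i) ≫ shift _ Y (ev f i) hk := by
    refine push_eq (f' := f') f (segment i).1 (act_clamp i hi) (inert_shift i hi) rfl ?_
      (inert_shift _ _) ?_ (act_clamp _ hk) (shift_clamp _ _)
    · rw [act_iff_ev, hf', hf']
      simp
    · refine ev_ext fun x hx => ?_
      rw [ev_comp, ev_comp, ev_shift, ev_shift, hf']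
      have h1 : ev f i ≤ ev f (i + min x 1) := ev_mono f (by omega)
      have h2 : ev f (i + min x 1) ≤ ev f (i + 1) := ev_mono f (by omega)
      simp only
      omega
  have hev : ∀ x, ev (push f (segment i).1).1 x =
      ev f i + min (min x Y.len - ev f i) (ev f (i + 1) - ev f i) := fun x => by
    rw [hpush, ev_comp, ev_shift, ev_clamp]
    simp only
    omega
  rw [covers_iff_ev]
  unfold Moment.Sub
  constructor
  · intro h
    have h0 := congrArg (fun t => ev t j) h
    have h1 := congrArg (fun t => ev t (j + 1)) h
    simp only [ev_comp, hev, ev_segment] at h0 h1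
    omega
  · intro h
    refine ev_ext fun x hx => ?_
    rw [ev_comp, hev, ev_segment]
    omega

lemma covers_iff_sub (f : X ⟶ Y) (α : El X) (β : El Y) :
    Covers f ((segmentEquiv X).symm α) ((segmentEquiv Y).symm β) ↔ β.1.Sub (push f α.1) := by
  obtain ⟨i, rfl⟩ := (segmentEquiv X).surjective α
  obtain ⟨j, rfl⟩ := (segmentEquiv Y).surjective β
  rw [Equiv.symm_apply_apply, Equiv.symm_apply_apply]
  exact (segment_sub_push f i j).symm

end Segments

/-! ### Comparison of the two wreath products, and Θ_n -/

section Comparison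

attribute [local instance] simplex_isUnital
variable {D : Type u₂} [Category.{v₂} D]

lemma DeltaWreath.comp_app {X Y Z : DeltaWreath D} {f : X ⟶ Y} {g : Y ⟶ Z} {i : Fin X.base.len}
    {j : Fin Y.base.len} {k : Fin Z.base.len} (h₁ : Covers (Hom.base f) i j)
    (h₂ : Covers (Hom.base g) j k) (h : Covers (Hom.base (f ≫ g)) i k) :
    Hom.app (f ≫ g) i k h = Hom.app f i j h₁ ≫ Hom.app g j k h₂ :=
  Hom.comp_app f g i j k h₁ h₂ h

/-- The comparison functor from the classical wreath product of the simplex category with `D`. -/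
noncomputable def comparison (D : Type u₂) [Category.{v₂} D] :
    DeltaWreath D ⥤ Wreath SimplexCategory D where
  obj X := ⟨X.base, fun α => X.fam ((segmentEquiv X.base).symm α)⟩
  map {X Y} f := (⟨DeltaWreath.Hom.base f, fun α β h =>
    DeltaWreath.Hom.app f _ _ ((covers_iff_sub _ α β).2 h)⟩ : Wreath.Hom _ _)
  map_id X := Wreath.eq_id rfl fun _ _ => rfl
  map_comp {X Y Z} f g := by
    refine Wreath.hom_ext rfl fun α γ h h' => ?_
    obtain ⟨β, h1, h2⟩ := El.exists_mid (DeltaWreath.Hom.base f) (DeltaWreath.Hom.base g) α γ h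
    refine Eq.trans ?_ (Wreath.comp_app _ _ h1 h2 h').symm
    exact DeltaWreath.comp_app ((covers_iff_sub _ α β).2 h1) ((covers_iff_sub _ β γ).2 h2)
      ((covers_iff_sub (DeltaWreath.Hom.base (f ≫ g)) α γ).2 h)

/-- Passing through `segmentEquiv` and back returns an index only up to a propositional equality;
this moves components along it in the proof of fullness. -/
lemma Wreath.eqToHom_app {C : Type u₁} [Category.{v₁} C] [ActiveInert C] [IsMomentCategory C]
    {X Y : Wreath C D} (f : X ⟶ Y) {α α' : El X.base}
    {β β' : El Y.base} (hα : α = α') (hβ : β = β') (h : β.1.Sub (push (Hom.base f) α.1)) :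
    Hom.app f α β h = eqToHom (by rw [hα]) ≫ Hom.app f α' β' (by rwa [← hα, ← hβ]) ≫
      eqToHom (by rw [hβ]) := by
  subst hα hβ
  simp

instance : (comparison D).Faithful where
  map_injective {X Y f g} h := by
    refine DeltaWreath.Hom.ext' _ _ (congrArg Wreath.Hom.base h) fun i j h1 h2 => ?_
    -- With indices of this form the components are by definition those of the images under the
    -- functor.
    obtain ⟨α, rfl⟩ := (segmentEquiv X.base).symm.surjective i
    obtain ⟨β, rfl⟩ := (segmentEquiv Y.base).symm.surjective j
    have h1' := (covers_iff_sub _ α β).1 h1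
    have h2' := (covers_iff_sub _ α β).1 h2
    change Wreath.Hom.app ((comparison D).map f) α β h1' =
      Wreath.Hom.app ((comparison D).map g) α β h2'
    congr 1

instance : (comparison D).Full where
  map_surjective {X Y} g := by
    refine ⟨(⟨Wreath.Hom.base g, fun i j h => eqToHom (by simp [comparison]) ≫
      Wreath.Hom.app g (segmentEquiv X.base i) (segmentEquiv Y.base j)
        ((segment_sub_push _ i j).2 h) ≫ eqToHom (by simp [comparison])⟩ :
        DeltaWreath.Hom X Y), Wreath.hom_ext rfl fun α β h h' => ?_⟩
    exact (Wreath.eqToHom_app g ((segmentEquiv X.base).apply_symm_apply α).symm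
      ((segmentEquiv Y.base).apply_symm_apply β).symm h').symm

instance : (comparison D).EssSurj where
  mem_essImage X := by
    refine ⟨⟨X.base, fun i => X.fam (segmentEquiv X.base i)⟩, ⟨eqToIso ?_⟩⟩
    simp [comparison]

instance : (comparison D).IsEquivalence where

lemma comparison_detects [ActiveInert D] : DetectsActiveInert (comparison D) where
  act_iff {X Y} f := by
    refine and_congr_right fun _ => ⟨fun h i j hij => ?_, fun h α β _ => h _ _ _⟩
    obtain ⟨α, rfl⟩ := (segmentEquiv X.base).symm.surjective i
    obtain ⟨β, rfl⟩ := (segmentEquiv Y.base).symm.surjective j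
    exact h α β ((covers_iff_sub _ α β).1 hij)
  inert_iff {X Y} f := by
    refine and_congr_right fun _ => ⟨fun h i j hij => ?_, fun h α β _ => h _ _ _⟩
    obtain ⟨α, rfl⟩ := (segmentEquiv X.base).symm.surjective i
    obtain ⟨β, rfl⟩ := (segmentEquiv Y.base).symm.surjective j
    exact h α β ((covers_iff_sub _ α β).1 hij)

theorem DeltaWreath.isUnital [ActiveInert D] [IsUnital D] (hD : HasEssentiallyUniqueUnit D) :
    IsUnital (DeltaWreath D) ∧ HasEssentiallyUniqueUnit (DeltaWreath D) := by
  have := Wreath.isUnital (C := SimplexCategory) hD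
  have := comparison_detects (D := D).isMomentCategory
  exact ⟨comparison_detects.isUnital, comparison_detects.hasEssentiallyUniqueUnit
    (Wreath.hasEssentiallyUniqueUnit simplex_hasEssentiallyUniqueUnit hD)⟩

/-- Uniqueness of the unit is carried through the induction because the next wreath product needs
it. The induction starts at Θ_1: the terminal category Θ_0 has no non-identity moment, hence no
unit. -/
theorem theta_isUnital (n : ℕ) :
    IsUnital (Theta (n + 1)) ∧ HasEssentiallyUniqueUnit (Theta (n + 1)) := by
  induction n with
  | zero =>
    exact ⟨inferInstanceAs (IsUnital SimplexCategory), simplex_hasEssentiallyUniqueUnit⟩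
  | succ n ih =>
    have := ih.1
    exact DeltaWreath.isUnital ih.2

end Comparison

end MomentCat

theorem mainTheorem7 :
    (∀ (C : Type u₁) [Category.{v₁} C] [ActiveInert C] [IsUnital C]
      (D : Type u₂) [Category.{v₂} D] [ActiveInert D] [IsUnital D],
      IsMomentCategory (Wreath C D) ∧
      (HasEssentiallyUniqueUnit D →
        IsUnital (Wreath C D) ∧
        (HasEssentiallyUniqueUnit C → HasEssentiallyUniqueUnit (Wreath C D)))) ∧
    (∃ _ : IsUnital SimplexCategory, ∀ n : ℕ, 1 ≤ n →
      IsUnital (Theta n) ∧ HasEssentiallyUniqueUnit (Theta n) ∧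
      ∃ e : Theta (n + 1) ≌ Wreath SimplexCategory (Theta n),
        ∀ {S T : Theta (n + 1)} (f : S ⟶ T),
          (ActiveInert.act (e.functor.map f) ↔ ActiveInert.act f) ∧
          (ActiveInert.inert (e.functor.map f) ↔ ActiveInert.inert f)) := by
  have := simplex_isUnital
  refine ⟨fun C _ _ _ D _ _ _ => ⟨inferInstance, fun hD => ⟨Wreath.isUnital hD,
    fun hC => Wreath.hasEssentiallyUniqueUnit hC hD⟩⟩, simplex_isUnital,
    fun n hn => ?_⟩
  obtain ⟨n, rfl⟩ := Nat.exists_eq_add_of_le' hn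
  obtain ⟨h, h'⟩ := theta_isUnital n
  exact ⟨h, h', (comparison (Theta (n + 1))).asEquivalence, fun f =>
    ⟨comparison_detects.act_iff f, comparison_detects.inert_iff f⟩⟩
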